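/- Let $\mathcal M$ be a finite-dimensional smooth Riemannian manifold with Levi-Civita connection $\nabla$, let $V\subseteq\mathcal M\times\mathbb R$ be open and let $f\in C^4(V,\mathbb R)$. Write $\operatorname{grad} f(w,\lambda)$ and $\operatorname{Hess} f(w,\lambda)[\xi]=\nabla_\xi \operatorname{grad} f(w,\lambda)$ for the Riemannian gradient and Hessian of $f(\cdot,\lambda)$ at $w$, and, where the Hessian is invertible, $$t(w,\lambda)=-\operatorname{Hess} f(w,\lambda)^{-1}\Big[\tfrac{\partial}{\partial\lambda}\operatorname{grad} f(w,\lambda)\Big],\qquad n(w,\lambda)=-\operatorname{Hess} f(w,\lambda)^{-1}\big[\operatorname{grad} f(w,\lambda)\big].$$ Let $R:T\mathcal M\to\mathcal M$ be a retraction, i.e. a smooth map with $R_x(0_x)=x$ and $\mathrm D R_x(0_x)=\mathrm{Id}_{T_x\mathcal M}$ for all $x$. Let $\mathcal T$ be a vector transport, i.e. a family of linear maps $\mathcal T_{y\to x}:T_y\mathcal M\to T_x\mathcal M$ that depends smoothly on $(y,x)$ near the diagonal and satisfies $\mathcal T_{x\to x}=\mathrm{Id}$. Let $x(\lambda)$,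 $\lambda\in[0,1]$, be a solution curve: $x$ is a $C^1$ curve on an open interval containing $[0,1]$, and for all $\lambda\in[0,1]$ one has $(x(\lambda),\lambda)\in V$, $\operatorname{grad} f(x(\lambda),\lambda)=0$, and $\operatorname{Hess} f(x(\lambda),\lambda)$ has full rank. For a point $(x,\lambda)=(x(\lambda),\lambda)$ of this curve and $h$ near $0$ put $$y(h)=R_x(h\,t(x,\lambda)),\qquad z(h)=R_{y(h)}\big(n(y(h),\lambda+h)\big),$$ $$\delta(x,\lambda,h)=\|n(y(h),\lambda+h)\|,\qquad \kappa(x,\lambda,h)=\frac{\|n(z(h),\lambda+h)\|}{\|n(y(h),\lambda+h)\|},$$ and, if $t(x,\lambda)\neq0$, $$\alpha(x,\lambda,h)=\arccos\left\langle \frac{t(x,\lambda)}{\|t(x,\lambda)\|},\frac{\mathcal T_{y(h)\to x}\big(t(y(h),\lambda+h)\big)}{\big\|\mathcal T_{y(h)\to x}\big(t(y(h),\lambda+h)\big)\big\|}\right\rangle_x .$$ Assume that for every point $(x,\lambda)$ of the solution curve $$\frac{\mathrm D^2}{\mathrm dh^2}\,n(y(h),\lambda+h)\Big|_{h=0}\neq0,$$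 where $\mathrm D/\mathrm dh$ is the covariant derivative along the path $h\mapsto y(h)$. Then there exist real-valued functions $\delta_2(x,\lambda)$, $\kappa_2(x,\lambda)$, $\alpha_1(x,\lambda)$, depending only on $x$ and $\lambda$, such that for every point $(x,\lambda)$ of the solution curve, as $h\to0^+$: 1. $\delta(x,\lambda,h)=\delta_2(x,\lambda)\,h^2+O(h^3)$; 2. $\kappa(x,\lambda,h)=\kappa_2(x,\lambda)\,h^2+o(h^2)$; 3. if $t(x,\lambda)\neq0$, then $\alpha(x,\lambda,h)=\alpha_1(x,\lambda)\,h+O(h^2)$. -/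

import Mathlib

open Bundle Manifold Set Filter Topology Asymptotics
open scoped ContDiff

namespace RiemannianContinuation

noncomputable section

section Connection

variable {E : Type*} [NormedAddCommGroup E] [NormedSpace ℝ E]
  {M : Type*} [TopologicalSpace M] [ChartedSpace E M] [IsManifold 𝓘(ℝ, E) ∞ M]
  [RiemannianBundle (fun x : M ↦ TangentSpace 𝓘(ℝ, E) x)]

/-- The right-hand side of the Koszul formula, i.e. the expression that equals
`2 ⟨∇_X Y, Z⟩` at `x` for the Levi-Civita connection `∇`. -/
def koszul (X Y Z : Π x : M, TangentSpace 𝓘(ℝ, E) x) (x : M) : ℝ :=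
  mvfderiv 𝓘(ℝ, E) (fun p ↦ inner ℝ (Y p) (Z p)) x (X x)
    + mvfderiv 𝓘(ℝ, E) (fun p ↦ inner ℝ (X p) (Z p)) x (Y x)
    - mvfderiv 𝓘(ℝ, E) (fun p ↦ inner ℝ (X p) (Y p)) x (Z x)
    + inner ℝ (VectorField.mlieBracket 𝓘(ℝ, E) X Y x) (Z x)
    - inner ℝ (VectorField.mlieBracket 𝓘(ℝ, E) X Z x) (Y x)
    - inner ℝ (VectorField.mlieBracket 𝓘(ℝ, E) Y Z x) (X x)

theorem clm_ext_inner {x : M} {A B : TangentSpace 𝓘(ℝ, E) x →L[ℝ] TangentSpace 𝓘(ℝ, E) x}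
    (h : ∀ X Z : Π x : M, TangentSpace 𝓘(ℝ, E) x, MDiffAt (T% X) x → MDiffAt (T% Z) x →
      inner ℝ (A (X x)) (Z x) = inner ℝ (B (X x)) (Z x)) : A = B := by
  ext v
  refine ext_inner_right ℝ fun w ↦ ?_
  simpa using h (FiberBundle.extend E v) (FiberBundle.extend E w)
    (FiberBundle.mdifferentiableAt_extend ..) (FiberBundle.mdifferentiableAt_extend ..)

variable [IsContMDiffRiemannianBundle 𝓘(ℝ, E) ∞ E (fun x : M ↦ TangentSpace 𝓘(ℝ, E) x)]

theorem mdiffAt_inner {x : M} {Y Z : Π x : M, TangentSpace 𝓘(ℝ, E) x}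
    (hY : MDiffAt (T% Y) x) (hZ : MDiffAt (T% Z) x) :
    MDiffAt (fun p ↦ inner ℝ (Y p) (Z p)) x :=
  MDifferentiableAt.inner_bundle (IB := 𝓘(ℝ, E)) (F := E)
    (E := fun x : M ↦ TangentSpace 𝓘(ℝ, E) x) (b := fun x : M ↦ x) hY hZ

variable [FiniteDimensional ℝ E]

theorem koszul_smul_left {x : M} {X Y Z : Π x : M, TangentSpace 𝓘(ℝ, E) x} {g : M → ℝ}
    (hg : MDiffAt g x) (hX : MDiffAt (T% X) x) (hY : MDiffAt (T% Y) x) (hZ : MDiffAt (T% Z) x) :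
    koszul (g • X) Y Z x = g x * koszul X Y Z x := by
  have : CompleteSpace E := FiniteDimensional.complete ℝ E
  simp only [koszul, Pi.smul_apply', real_inner_smul_left, real_inner_smul_right,
    mvfderiv_fun_mul hg (mdiffAt_inner hX hZ), mvfderiv_fun_mul hg (mdiffAt_inner hX hY),
    VectorField.mlieBracket_smul_left hg hX, inner_add_left]
  simp [real_inner_comm]
  ring

theorem koszul_smul_right {x : M} {X Y Z : Π x : M, TangentSpace 𝓘(ℝ, E) x} {g : M → ℝ}
    (hg : MDiffAt g x) (hX : MDiffAt (T% X) x) (hY : MDiffAt (T% Y) x) (hZ : MDiffAt (T% Z) x) :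
    koszul X Y (g • Z) x = g x * koszul X Y Z x := by
  have : CompleteSpace E := FiniteDimensional.complete ℝ E
  simp only [koszul, Pi.smul_apply', real_inner_smul_left, real_inner_smul_right,
    mvfderiv_fun_mul hg (mdiffAt_inner hX hZ), mvfderiv_fun_mul hg (mdiffAt_inner hY hZ),
    VectorField.mlieBracket_smul_right hg hZ, inner_add_left]
  simp [real_inner_comm]
  ring

theorem koszul_smul_mid {x : M} {X Y Z : Π x : M, TangentSpace 𝓘(ℝ, E) x} {g : M → ℝ}
    (hg : MDiffAt g x) (hX : MDiffAt (T% X) x) (hY : MDiffAt (T% Y) x) (hZ : MDiffAt (T% Z) x) :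
    koszul X (g • Y) Z x
      = g x * koszul X Y Z x + 2 * (mvfderiv 𝓘(ℝ, E) g x (X x) * inner ℝ (Y x) (Z x)) := by
  have : CompleteSpace E := FiniteDimensional.complete ℝ E
  simp only [koszul, Pi.smul_apply', real_inner_smul_left, real_inner_smul_right,
    mvfderiv_fun_mul hg (mdiffAt_inner hX hY), mvfderiv_fun_mul hg (mdiffAt_inner hY hZ),
    VectorField.mlieBracket_smul_right hg hY, VectorField.mlieBracket_smul_left hg hY,
    inner_add_left]
  simp [real_inner_comm]
  ring

theorem koszul_add_left {x : M} {X X' Y Z : Π x : M, TangentSpace 𝓘(ℝ, E) x}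
    (hX : MDiffAt (T% X) x) (hX' : MDiffAt (T% X') x)
    (hY : MDiffAt (T% Y) x) (hZ : MDiffAt (T% Z) x) :
    koszul (X + X') Y Z x = koszul X Y Z x + koszul X' Y Z x := by
  have : CompleteSpace E := FiniteDimensional.complete ℝ E
  simp only [koszul, Pi.add_apply, inner_add_left, inner_add_right,
    mvfderiv_fun_add (mdiffAt_inner hX hZ) (mdiffAt_inner hX' hZ),
    mvfderiv_fun_add (mdiffAt_inner hX hY) (mdiffAt_inner hX' hY),
    VectorField.mlieBracket_add_left hX hX']
  simp
  ring

theorem koszul_add_right {x : M} {X Y Z Z' : Π x : M, TangentSpace 𝓘(ℝ, E) x}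
    (hX : MDiffAt (T% X) x) (hY : MDiffAt (T% Y) x)
    (hZ : MDiffAt (T% Z) x) (hZ' : MDiffAt (T% Z') x) :
    koszul X Y (Z + Z') x = koszul X Y Z x + koszul X Y Z' x := by
  have : CompleteSpace E := FiniteDimensional.complete ℝ E
  simp only [koszul, Pi.add_apply, inner_add_left, inner_add_right,
    mvfderiv_fun_add (mdiffAt_inner hX hZ) (mdiffAt_inner hX hZ'),
    mvfderiv_fun_add (mdiffAt_inner hY hZ) (mdiffAt_inner hY hZ'),
    VectorField.mlieBracket_add_right hZ hZ']
  simp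
  ring

theorem koszul_add_mid {x : M} {X Y Y' Z : Π x : M, TangentSpace 𝓘(ℝ, E) x}
    (hX : MDiffAt (T% X) x) (hY : MDiffAt (T% Y) x)
    (hY' : MDiffAt (T% Y') x) (hZ : MDiffAt (T% Z) x) :
    koszul X (Y + Y') Z x = koszul X Y Z x + koszul X Y' Z x := by
  have : CompleteSpace E := FiniteDimensional.complete ℝ E
  simp only [koszul, Pi.add_apply, inner_add_left, inner_add_right,
    mvfderiv_fun_add (mdiffAt_inner hX hY) (mdiffAt_inner hX hY'),
    mvfderiv_fun_add (mdiffAt_inner hY hZ) (mdiffAt_inner hY' hZ),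
    VectorField.mlieBracket_add_left hY hY', VectorField.mlieBracket_add_right hY hY']
  simp
  ring

theorem koszul_tensorial_left {x : M} {Y Z : Π x : M, TangentSpace 𝓘(ℝ, E) x}
    (hY : MDiffAt (T% Y) x) (hZ : MDiffAt (T% Z) x) :
    TensorialAt 𝓘(ℝ, E) E (fun X ↦ koszul X Y Z x) x where
  smul hg hX := koszul_smul_left hg hX hY hZ
  add hX hX' := koszul_add_left hX hX' hY hZ

theorem koszul_tensorial_right {x : M} {X Y : Π x : M, TangentSpace 𝓘(ℝ, E) x}
    (hX : MDiffAt (T% X) x) (hY : MDiffAt (T% Y) x) :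
    TensorialAt 𝓘(ℝ, E) E (fun Z ↦ koszul X Y Z x) x where
  smul hg hZ := koszul_smul_right hg hX hY hZ
  add hZ hZ' := koszul_add_right hX hY hZ hZ'

/-- The tangent spaces, with the norm given by the Riemannian metric, are complete. -/
instance completeSpace_tangentSpace (x : M) : CompleteSpace (TangentSpace 𝓘(ℝ, E) x) :=
  have : FiniteDimensional ℝ (TangentSpace 𝓘(ℝ, E) x) := inferInstanceAs (FiniteDimensional ℝ E)
  FiniteDimensional.complete ℝ (TangentSpace 𝓘(ℝ, E) x)

open scoped Classical in
/-- `∇_v Y` at `x` for the Levi-Civita connection: the vector of `T_xM` that represents the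
functional `Z ↦ koszul v Y Z / 2`. It is set to `0` if the vector field `Y` is not differentiable
at `x`. -/
def leviCivitaFun (Y : Π x : M, TangentSpace 𝓘(ℝ, E) x) (x : M) :
    TangentSpace 𝓘(ℝ, E) x →L[ℝ] TangentSpace 𝓘(ℝ, E) x :=
  if hY : MDiffAt (T% Y) x then
    ((InnerProductSpace.toDual ℝ
        (TangentSpace 𝓘(ℝ, E) x)).symm.toContinuousLinearEquiv.toContinuousLinearMap).comp
      ((1 / 2 : ℝ) • TensorialAt.mkHom₂ (I := 𝓘(ℝ, E)) (F := E) (F' := E)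
        (fun X Z ↦ koszul X Y Z x) x
        (fun _ hZ ↦ koszul_tensorial_left hY hZ) (fun _ hX ↦ koszul_tensorial_right hX hY))
  else 0

theorem inner_leviCivitaFun {x : M} {X Y Z : Π x : M, TangentSpace 𝓘(ℝ, E) x}
    (hX : MDiffAt (T% X) x) (hY : MDiffAt (T% Y) x) (hZ : MDiffAt (T% Z) x) :
    inner ℝ (leviCivitaFun Y x (X x)) (Z x) = (1 / 2 : ℝ) * koszul X Y Z x := by
  have h := TensorialAt.mkHom₂_apply (Φ := fun X Z ↦ koszul X Y Z x)
    (fun _ hZ ↦ koszul_tensorial_left hY hZ) (fun _ hX ↦ koszul_tensorial_right hX hY) hX hZ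
  rw [leviCivitaFun, dif_pos hY, ← h]
  simp [real_inner_smul_left, InnerProductSpace.toDual_symm_apply]

variable (E M) in
/-- The Levi-Civita (Riemannian) connection of `M`. -/
def leviCivita : CovariantDerivative 𝓘(ℝ, E) E (fun x : M ↦ TangentSpace 𝓘(ℝ, E) x) where
  toFun := leviCivitaFun
  isCovariantDerivativeOnUniv :=
    { add := by
        intro Y Y' x hY hY' _
        refine clm_ext_inner fun X Z hX hZ ↦ ?_
        have hs : MDiffAt (T% (Y + Y')) x := mdifferentiableAt_add_section hY hY'
        rw [inner_leviCivitaFun hX hs hZ, koszul_add_mid hX hY hY' hZ,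
          add_apply, inner_add_left, inner_leviCivitaFun hX hY hZ,
          inner_leviCivitaFun hX hY' hZ]
        ring
      leibniz := by
        intro Y g x hY hg _
        refine clm_ext_inner fun X Z hX hZ ↦ ?_
        have hs : MDiffAt (T% (g • Y)) x := hg.smul_section hY
        rw [inner_leviCivitaFun hX hs hZ, koszul_smul_mid hg hX hY hZ,
          add_apply, inner_add_left, smul_apply,
          ContinuousLinearMap.smulRight_apply, real_inner_smul_left, real_inner_smul_left,
          inner_leviCivitaFun hX hY hZ]
        ring }

/-- The connection is compatible with the metric. -/
theorem leviCivita_metric {x : M} {X Y Z : Π x : M, TangentSpace 𝓘(ℝ, E) x}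
    (hX : MDiffAt (T% X) x) (hY : MDiffAt (T% Y) x) (hZ : MDiffAt (T% Z) x) :
    mvfderiv 𝓘(ℝ, E) (fun p ↦ inner ℝ (Y p) (Z p)) x (X x)
      = inner ℝ (leviCivita E M Y x (X x)) (Z x) + inner ℝ (Y x) (leviCivita E M Z x (X x)) := by
  change _ = inner ℝ (leviCivitaFun Y x (X x)) (Z x) + inner ℝ (Y x) (leviCivitaFun Z x (X x))
  rw [real_inner_comm (leviCivitaFun Z x (X x)), inner_leviCivitaFun hX hY hZ,
    inner_leviCivitaFun hX hZ hY]
  simp only [koszul]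
  rw [VectorField.mlieBracket_swap_apply (V := Z) (W := Y)]
  simp [real_inner_comm]
  ring

/-- The connection is torsion-free. -/
theorem leviCivita_torsion : (leviCivita E M).torsion = 0 := by
  have : CompleteSpace E := FiniteDimensional.complete ℝ E
  rw [CovariantDerivative.torsion_eq_zero_iff]
  intro X Y x hX hY
  refine ext_inner_right ℝ fun w ↦ ?_
  have hZ : MDiffAt (T% (FiberBundle.extend E w)) x := FiberBundle.mdifferentiableAt_extend ..
  have h1 := inner_leviCivitaFun hX hY hZ
  have h2 := inner_leviCivitaFun hY hX hZ
  rw [FiberBundle.extend_apply_self] at h1 h2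
  change inner ℝ (leviCivitaFun Y x (X x) - leviCivitaFun X x (Y x)) w = _
  rw [inner_sub_left, h1, h2]
  simp only [koszul, FiberBundle.extend_apply_self]
  rw [VectorField.mlieBracket_swap_apply (V := Y) (W := X)]
  simp [real_inner_comm]
  ring

variable (E)

/-- The Riemannian gradient of `g` at `x`: the vector of `T_xM` representing the differential. -/
def grad (g : M → ℝ) (x : M) : TangentSpace 𝓘(ℝ, E) x :=
  (InnerProductSpace.toDual ℝ (TangentSpace 𝓘(ℝ, E) x)).symm (mvfderiv 𝓘(ℝ, E) g x)

/-- The Riemannian Hessian of `g` at `x`, i.e. the linear map `v ↦ ∇_v grad g` on `T_xM`. -/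
def hess (g : M → ℝ) (x : M) : TangentSpace 𝓘(ℝ, E) x →L[ℝ] TangentSpace 𝓘(ℝ, E) x :=
  leviCivita E M (grad E g) x

/-- The derivative with respect to the parameter, at `l`, of the curve `μ ↦ grad f(w, μ)` in the
fixed vector space `T_wM`. -/
def gradParamDeriv (f : M × ℝ → ℝ) (w : M) (l : ℝ) : TangentSpace 𝓘(ℝ, E) w :=
  deriv (fun μ : ℝ ↦ grad E (fun p ↦ f (p, μ)) w) l

/-- The prediction vector `t(w, l) = - Hess f(w, l)⁻¹ [∂ grad f(w, l) / ∂l]`. -/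
def predictionVector (f : M × ℝ → ℝ) (w : M) (l : ℝ) : TangentSpace 𝓘(ℝ, E) w :=
  -(hess E (fun p ↦ f (p, l)) w).inverse (gradParamDeriv E f w l)

/-- The Riemannian Newton update vector `n(w, l) = - Hess f(w, l)⁻¹ [grad f(w, l)]`. -/
def newtonVector (f : M × ℝ → ℝ) (w : M) (l : ℝ) : TangentSpace 𝓘(ℝ, E) w :=
  -(hess E (fun p ↦ f (p, l)) w).inverse (grad E (fun p ↦ f (p, l)) w)

variable {E}

/-- The covariant derivative `DX/dh` (for the Levi-Civita connection) of a vector field `X` along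
a curve `y` in `M`, at the parameter `h`. In the local frame `e_i` of `TM` given by the
trivialization at `y h`, where `X s = ∑ X^i(s) e_i(y s)`, it is
`∑ (X^i)'(h) e_i(y h) + ∑ X^i(h) ∇_{y'(h)} e_i`. The vector field `∑ X^i(h) e_i`, with
coefficients frozen at `h`, is `FiberBundle.extend E (X h)`. -/
def covDerivAlong (y : ℝ → M) (X : Π h : ℝ, TangentSpace 𝓘(ℝ, E) (y h)) (h : ℝ) :
    TangentSpace 𝓘(ℝ, E) (y h) :=
  (trivializationAt E (fun p : M ↦ TangentSpace 𝓘(ℝ, E) p) (y h)).symm (y h)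
      (deriv (fun s : ℝ ↦
        (trivializationAt E (fun p : M ↦ TangentSpace 𝓘(ℝ, E) p) (y h) ⟨y s, X s⟩).2) h)
    + leviCivita E M (FiberBundle.extend E (X h)) (y h)
        (mfderiv 𝓘(ℝ, ℝ) 𝓘(ℝ, E) y h (1 : ℝ))

/-- A `C¹` curve of critical points of `f(·, l)`, `l ∈ [0, 1]`, inside the domain `V` of `f`, along
which the Riemannian Hessian has full rank. -/
structure IsSolutionCurve (V : Set (M × ℝ)) (f : M × ℝ → ℝ) (x : ℝ → M) : Prop where
  contMDiffOn : ∃ J : Set ℝ, IsOpen J ∧ J.OrdConnected ∧ Icc 0 1 ⊆ J ∧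
    ContMDiffOn 𝓘(ℝ, ℝ) 𝓘(ℝ, E) 1 x J
  mem : ∀ l ∈ Icc (0 : ℝ) 1, (x l, l) ∈ V
  grad_eq_zero : ∀ l ∈ Icc (0 : ℝ) 1, grad E (fun p ↦ f (p, l)) (x l) = 0
  hess_isInvertible : ∀ l ∈ Icc (0 : ℝ) 1, (hess E (fun p ↦ f (p, l)) (x l)).IsInvertible

end Connection

section Retraction

variable {E : Type*} [NormedAddCommGroup E] [NormedSpace ℝ E]
  {M : Type*} [TopologicalSpace M] [ChartedSpace E M] [IsManifold 𝓘(ℝ, E) ∞ M]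

/-- A retraction: a smooth map `R : TM → M` with `R_x(0) = x` and `D R_x(0) = id`. -/
structure IsRetraction (R : TangentBundle 𝓘(ℝ, E) M → M) : Prop where
  contMDiff : ContMDiff 𝓘(ℝ, E).tangent 𝓘(ℝ, E) ∞ R
  map_zero : ∀ x : M, R ⟨x, 0⟩ = x
  hasMFDerivAt_zero : ∀ x : M, HasMFDerivAt 𝓘(ℝ, E) 𝓘(ℝ, E) (fun v : E ↦ R ⟨x, v⟩) 0
    (ContinuousLinearMap.id ℝ E)

/-- A vector transport, as a family of linear maps `𝒯_{y → x} : T_yM → T_xM` that is smooth near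
the diagonal of `M × M` (that is, `(v, x) ↦ 𝒯_{π(v) → x} v` is a smooth map `TM × M → TM` near the
pairs `(v, x)` with `v ∈ T_xM`) and satisfies `𝒯_{x → x} = id`. -/
structure IsVectorTransport
    (T : Π y x : M, TangentSpace 𝓘(ℝ, E) y →L[ℝ] TangentSpace 𝓘(ℝ, E) x) : Prop where
  contMDiffAt : ∀ (x : M) (v : TangentSpace 𝓘(ℝ, E) x),
    ContMDiffAt (𝓘(ℝ, E).tangent.prod 𝓘(ℝ, E)) 𝓘(ℝ, E).tangent ∞
      (fun p : TangentBundle 𝓘(ℝ, E) M × M ↦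
        (⟨p.2, T p.1.proj p.2 p.1.snd⟩ : TangentBundle 𝓘(ℝ, E) M))
      (⟨x, v⟩, x)
  map_self : ∀ x : M, T x x = ContinuousLinearMap.id ℝ (TangentSpace 𝓘(ℝ, E) x)

end Retraction

section Indicators

variable {E : Type*} [NormedAddCommGroup E] [NormedSpace ℝ E] [FiniteDimensional ℝ E]
  {M : Type*} [TopologicalSpace M] [ChartedSpace E M] [IsManifold 𝓘(ℝ, E) ∞ M]
  [RiemannianBundle (fun x : M ↦ TangentSpace 𝓘(ℝ, E) x)]
  [IsContMDiffRiemannianBundle 𝓘(ℝ, E) ∞ E (fun x : M ↦ TangentSpace 𝓘(ℝ, E) x)]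
  (f : M × ℝ → ℝ) (R : TangentBundle 𝓘(ℝ, E) M → M)
  (T : Π y x : M, TangentSpace 𝓘(ℝ, E) y →L[ℝ] TangentSpace 𝓘(ℝ, E) x)

/-- The tangential prediction path `y(h) = R_x(h t(x, l))`. -/
def predictionPath (x : M) (l h : ℝ) : M :=
  R ⟨x, h • predictionVector E f x l⟩

/-- The Newton update vector `n(y(h), l + h)`, a vector field along the prediction path. -/
def firstUpdate (x : M) (l h : ℝ) : TangentSpace 𝓘(ℝ, E) (predictionPath f R x l h) :=
  newtonVector E f (predictionPath f R x l h) (l + h)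

/-- The first Newton iterate `z(h) = R_{y(h)}(n(y(h), l + h))`. -/
def firstIterate (x : M) (l h : ℝ) : M :=
  R ⟨predictionPath f R x l h, firstUpdate f R x l h⟩

/-- The norm `δ(x, l, h)` of the first Newton update vector. -/
def delta (x : M) (l h : ℝ) : ℝ :=
  ‖firstUpdate f R x l h‖

/-- The first contraction rate `κ(x, l, h)` of the Newton method. -/
def kappa (x : M) (l h : ℝ) : ℝ :=
  ‖newtonVector E f (firstIterate f R x l h) (l + h)‖ / ‖firstUpdate f R x l h‖

/-- The prediction vector `t(y(h), l + h)` transported to `T_xM`. -/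
def transportedPrediction (x : M) (l h : ℝ) : TangentSpace 𝓘(ℝ, E) x :=
  T (predictionPath f R x l h) x (predictionVector E f (predictionPath f R x l h) (l + h))

/-- The prediction angle `α(x, l, h)`. -/
def alpha (x : M) (l h : ℝ) : ℝ :=
  Real.arccos (inner ℝ (‖predictionVector E f x l‖⁻¹ • predictionVector E f x l)
    (‖transportedPrediction f R T x l h‖⁻¹ • transportedPrediction f R T x l h))

end Indicators

end

end RiemannianContinuation

/-! Fix a solution point (x, λ) and read everything in the chart at x. The gradient is the inverse
metric applied to the differential of f, hence of class C³. The Hessian is D grad + Γ(grad) with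
smooth Christoffel symbols Γ, so it is of class C², and so is its inverse near the point.

δ: the path c(h) = (y(h), λ + h) has velocity (t, 1) at h = 0, because D R_x(0) = id. The gradient
vanishes at x, so the Γ term drops out and (grad ∘ c)'(0) = Hess t + ∂grad/∂λ, which is 0 by the
choice of t. Thus grad(c(h)) = h² a + O(h³). Applying the inverse Hessian, needed only up to O(h),
gives n = h² v + O(h³) (`exists_isBigO_chartUpdate`), and the length of n in the metric at y(h)
expands accordingly (`exists_isBigO_sqrt_sub`).

κ: for a point a, let Ψ(a, w) be the gradient after a retraction step w from a, and expand it to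
second order in w, uniformly in a (`exists_isLittleO_taylor_two`). The Newton equation Hess n =
-grad cancels the terms of order zero and one, except for a Christoffel term that is itself
quadratic in n. The next Newton vector is therefore Q(n, n) + o(‖n‖²) with coefficients Q that
converge as h → 0 (`chartNewton_chartIterate`). If v ≠ 0, its length is of order h⁴ and is divided
by one of order h². If v = 0, the quotient is O(‖n‖) = O(h³). Both cases are in
`exists_isLittleO_sqrt_div_sub`.

α: the transported prediction vector is a C² curve τ in the fixed space T_xM with τ(0) = t. Since
arccos is not differentiable at 1, the angle is written as the arctangent of the length of a C²
curve that vanishes at 0 (`arccos_inner_eq_arctan`, `exists_isBigO_arccos_sub`). Such a length is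
linear in h up to O(h²) for h > 0. -/

namespace RiemannianContinuation

noncomputable section

set_option linter.unusedSectionVars false

/-! ### Charts and the coordinate frame of the tangent bundle -/

section Chart

variable {E : Type*} [NormedAddCommGroup E] [NormedSpace ℝ E]
  {M : Type*} [TopologicalSpace M] [ChartedSpace E M] [IsManifold 𝓘(ℝ, E) ∞ M]

/-- The vector of `T_pM` with coordinates `v` in the chart at `x₀`. -/
def chartFrame (x₀ p : M) : E →L[ℝ] TangentSpace 𝓘(ℝ, E) p :=
  (trivializationAt E (TangentSpace 𝓘(ℝ, E)) x₀).symmL ℝ p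

/-- The coordinates of a vector of `T_pM` in the chart at `x₀`. -/
def chartCoord (x₀ p : M) : TangentSpace 𝓘(ℝ, E) p →L[ℝ] E :=
  (trivializationAt E (TangentSpace 𝓘(ℝ, E)) x₀).continuousLinearMapAt ℝ p

theorem chartCoord_chartFrame {x₀ p : M} (hp : p ∈ (chartAt E x₀).source) (v : E) :
    chartCoord x₀ p (chartFrame x₀ p v) = v :=
  (trivializationAt E (TangentSpace 𝓘(ℝ, E)) x₀).continuousLinearMapAt_symmL hp v

theorem chartFrame_chartCoord {x₀ p : M} (hp : p ∈ (chartAt E x₀).source)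
    (v : TangentSpace 𝓘(ℝ, E) p) : chartFrame x₀ p (chartCoord x₀ p v) = v :=
  (trivializationAt E (TangentSpace 𝓘(ℝ, E)) x₀).symmL_continuousLinearMapAt hp v

/-- The linear isomorphism `T_pM ≃ E` given by the chart at `x₀`. -/
def chartEquiv {x₀ p : M} (hp : p ∈ (chartAt E x₀).source) : TangentSpace 𝓘(ℝ, E) p ≃L[ℝ] E :=
  ContinuousLinearEquiv.equivOfInverse (chartCoord x₀ p) (chartFrame x₀ p)
    (chartFrame_chartCoord hp) (chartCoord_chartFrame hp)

theorem chartCoord_eq {x₀ p : M} (hp : p ∈ (chartAt E x₀).source) (v : TangentSpace 𝓘(ℝ, E) p) :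
    chartCoord x₀ p v = (trivializationAt E (TangentSpace 𝓘(ℝ, E)) x₀ ⟨p, v⟩).2 :=
  (trivializationAt E (TangentSpace 𝓘(ℝ, E)) x₀).continuousLinearMapAt_apply_of_mem ℝ hp v

/-- The inverse of the chart at `x₀`, as a map from the model space. -/
def chartInv (x₀ : M) (u : E) : M := (chartAt E x₀).symm u

theorem isOpen_chartTarget (x₀ : M) : IsOpen (chartAt E x₀).target := (chartAt E x₀).open_target

theorem chartInv_mem {x₀ : M} {u : E} (hu : u ∈ (chartAt E x₀).target) :
    chartInv x₀ u ∈ (chartAt E x₀).source := (chartAt E x₀).map_target hu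

theorem contMDiffOn_chartInv (x₀ : M) :
    ContMDiffOn 𝓘(ℝ, E) 𝓘(ℝ, E) ∞ (chartInv x₀) (chartAt E x₀).target :=
  contMDiffOn_chart_symm

theorem contMDiffOn_chartFrame (x₀ : M) (v : E) :
    ContMDiffOn 𝓘(ℝ, E) 𝓘(ℝ, E).tangent ∞
      (fun p ↦ (⟨p, chartFrame x₀ p v⟩ : TangentBundle 𝓘(ℝ, E) M)) (chartAt E x₀).source := by
  have := (trivializationAt E (TangentSpace 𝓘(ℝ, E)) x₀).contMDiffOn_section_baseSet_iff
    (IB := 𝓘(ℝ, E)) (n := ∞) (s := fun p ↦ chartFrame x₀ p v)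
  refine this.2 ?_
  refine contMDiffOn_const (c := v) |>.congr fun p hp ↦ ?_
  rw [← chartCoord_eq hp, chartCoord_chartFrame hp]

theorem contMDiffAt_chartFrame {x₀ p : M} (hp : p ∈ (chartAt E x₀).source) (v : E) :
    ContMDiffAt 𝓘(ℝ, E) 𝓘(ℝ, E).tangent ∞
      (fun p ↦ (⟨p, chartFrame x₀ p v⟩ : TangentBundle 𝓘(ℝ, E) M)) p :=
  (contMDiffOn_chartFrame x₀ v).contMDiffAt ((chartAt E x₀).open_source.mem_nhds hp)

theorem mdifferentiableAt_chartFrame {x₀ p : M} (hp : p ∈ (chartAt E x₀).source) (v : E) :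
    MDiffAt (T% (fun p : M ↦ chartFrame x₀ p v)) p :=
  (contMDiffAt_chartFrame hp v).mdifferentiableAt (by simp)

theorem mfderiv_chartInv {x₀ p : M} (hp : p ∈ (chartAt E x₀).source) :
    mfderiv 𝓘(ℝ, E) 𝓘(ℝ, E) (chartInv x₀) (chartAt E x₀ p)
      = (chartFrame (E := E) x₀ p : E →L[ℝ] TangentSpace 𝓘(ℝ, E) p) := by
  have := TangentBundle.symmL_trivializationAt (I := 𝓘(ℝ, E)) hp
  simp only [modelWithCornersSelf_coe, range_id, mfderivWithin_univ] at this
  exact this.symm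

theorem mfderiv_chart {x₀ p : M} (hp : p ∈ (chartAt E x₀).source) :
    mfderiv 𝓘(ℝ, E) 𝓘(ℝ, E) (chartAt E x₀) p
      = (chartCoord (E := E) x₀ p : TangentSpace 𝓘(ℝ, E) p →L[ℝ] E) := by
  have := TangentBundle.continuousLinearMapAt_trivializationAt (I := 𝓘(ℝ, E)) hp
  exact this.symm

theorem mvfderiv_chartFrame {F : Type*} [NormedAddCommGroup F] [NormedSpace ℝ F] {x₀ : M} {u : E}
    (hu : u ∈ (chartAt E x₀).target) {g : M → F}
    (hg : MDiffAt g (chartInv x₀ u)) (v : E) :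
    mvfderiv 𝓘(ℝ, E) g (chartInv x₀ u) (chartFrame x₀ (chartInv x₀ u) v)
      = fderiv ℝ (fun u ↦ g (chartInv x₀ u)) u v := by
  have hp := chartInv_mem hu
  have h1 : MDifferentiableAt 𝓘(ℝ, E) 𝓘(ℝ, E) (chartInv x₀) u :=
    ((contMDiffOn_chartInv x₀).contMDiffAt ((isOpen_chartTarget x₀).mem_nhds hu)).mdifferentiableAt
      (by simp)
  have h2 : chartAt E x₀ (chartInv x₀ u) = u := (chartAt E x₀).right_inv hu
  have h3 := mfderiv_chartInv hp
  rw [h2] at h3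
  rw [← mfderiv_eq_fderiv, ← h3]
  have h4 := mfderiv_comp (I := 𝓘(ℝ, E)) (I' := 𝓘(ℝ, E)) (I'' := 𝓘(ℝ, F)) u hg h1
  rw [show (fun u ↦ g (chartInv x₀ u)) = g ∘ chartInv x₀ from rfl, h4]
  rfl

theorem contDiffOn_comp_chartInv {F : Type*} [NormedAddCommGroup F] [NormedSpace ℝ F] {x₀ : M}
    {n : ℕ∞ω} (hn : n ≤ ∞) {g : M → F}
    (hg : ContMDiffOn 𝓘(ℝ, E) 𝓘(ℝ, F) n g (chartAt E x₀).source) :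
    ContDiffOn ℝ n (fun u ↦ g (chartInv x₀ u)) (chartAt E x₀).target :=
  contMDiffOn_iff_contDiffOn.1
    (hg.comp ((contMDiffOn_chartInv x₀).of_le hn) fun _ hu ↦ chartInv_mem hu)

end Chart

/-! ### The metric in a chart -/

section Metric

variable {E : Type*} [NormedAddCommGroup E] [NormedSpace ℝ E] [FiniteDimensional ℝ E]
  {M : Type*} [TopologicalSpace M] [ChartedSpace E M] [IsManifold 𝓘(ℝ, E) ∞ M]
  [RiemannianBundle (fun x : M ↦ TangentSpace 𝓘(ℝ, E) x)]
  [IsContMDiffRiemannianBundle 𝓘(ℝ, E) ∞ E (fun x : M ↦ TangentSpace 𝓘(ℝ, E) x)]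

/-- The metric in the chart at `x₀`. -/
def chartMetric (x₀ : M) (u : E) : E →L[ℝ] E →L[ℝ] ℝ :=
  (innerSL ℝ : TangentSpace 𝓘(ℝ, E) (chartInv x₀ u) →L[ℝ]
    TangentSpace 𝓘(ℝ, E) (chartInv x₀ u) →L[ℝ] ℝ).bilinearComp
    (chartFrame x₀ (chartInv x₀ u)) (chartFrame x₀ (chartInv x₀ u))

theorem chartMetric_apply (x₀ : M) (u v w : E) :
    chartMetric x₀ u v w
      = inner ℝ (chartFrame x₀ (chartInv x₀ u) v) (chartFrame x₀ (chartInv x₀ u) w) := rfl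

theorem contDiffOn_chartMetric (x₀ : M) :
    ContDiffOn ℝ ∞ (chartMetric x₀) (chartAt E x₀).target := by
  refine contDiffOn_clm_apply.2 fun v ↦ contDiffOn_clm_apply.2 fun w ↦ ?_
  have := ContMDiffOn.inner_bundle (IB := 𝓘(ℝ, E)) (n := ∞) (F := E)
    (E := fun x : M ↦ TangentSpace 𝓘(ℝ, E) x) (b := fun x : M ↦ x) (contMDiffOn_chartFrame x₀ v)
    (contMDiffOn_chartFrame x₀ w)
  exact contDiffOn_comp_chartInv le_rfl this

/-- Positive definiteness makes the map injective, and E and its dual have the same finite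
dimension. -/
theorem isInvertible_chartMetric {x₀ : M} {u : E} (hu : u ∈ (chartAt E x₀).target) :
    (chartMetric x₀ u).IsInvertible := by
  have hinj : Function.Injective (chartMetric x₀ u).toLinearMap := by
    refine (injective_iff_map_eq_zero _).2 fun v hv ↦ ?_
    have h0 : chartMetric x₀ u v v = 0 := by
      have : chartMetric x₀ u v = 0 := hv
      simp [this]
    rw [chartMetric_apply, inner_self_eq_zero] at h0
    have := chartCoord_chartFrame (chartInv_mem hu) v
    rw [h0, map_zero] at this
    exact this.symm
  have hdim : Module.finrank ℝ E = Module.finrank ℝ (E →L[ℝ] ℝ) := by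
    rw [← (LinearMap.toContinuousLinearMap (𝕜 := ℝ) (E := E) (F' := ℝ)).finrank_eq]
    exact (Subspace.dual_finrank_eq).symm
  exact ⟨(LinearEquiv.ofInjectiveOfFinrankEq _ hinj hdim).toContinuousLinearEquiv, by ext; rfl⟩

end Metric

/-! ### Christoffel symbols and the Levi-Civita connection in a chart -/

section Hessian

variable {E : Type*} [NormedAddCommGroup E] [NormedSpace ℝ E] [FiniteDimensional ℝ E]
  {M : Type*} [TopologicalSpace M] [ChartedSpace E M] [IsManifold 𝓘(ℝ, E) ∞ M]
  [RiemannianBundle (fun x : M ↦ TangentSpace 𝓘(ℝ, E) x)]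
  [IsContMDiffRiemannianBundle 𝓘(ℝ, E) ∞ E (fun x : M ↦ TangentSpace 𝓘(ℝ, E) x)]

/-- The endomorphism `ξ ↦ ∇_ξ Y` in the chart at `x₀`, where `Y` has constant coordinates `v`. -/
def chartConnection (x₀ : M) (v u : E) : E →L[ℝ] E :=
  (chartCoord x₀ (chartInv x₀ u)).comp
    ((leviCivita E M (fun p ↦ chartFrame x₀ p v) (chartInv x₀ u)).comp
      (chartFrame x₀ (chartInv x₀ u)))

/-- The Christoffel symbols in the chart at `x₀`. -/
def christoffel (x₀ : M) (u : E) : E →L[ℝ] E →L[ℝ] E :=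
  ∑ i, ((Module.finBasis ℝ E).coord i).toContinuousLinearMap.smulRight
    (chartConnection x₀ (Module.finBasis ℝ E i) u)

theorem contDiffOn_fderiv_inner_chartFrame (x₀ : M) (v w z : E) :
    ContDiffOn ℝ ∞ (fun u ↦ mvfderiv 𝓘(ℝ, E)
        (fun p ↦ inner ℝ (chartFrame x₀ p v) (chartFrame x₀ p w)) (chartInv x₀ u)
        (chartFrame x₀ (chartInv x₀ u) z)) (chartAt E x₀).target := by
  have h1 : ContDiffOn ℝ ∞ (fun u ↦ chartMetric x₀ u v w) (chartAt E x₀).target :=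
    ((contDiffOn_chartMetric x₀).clm_apply contDiffOn_const).clm_apply contDiffOn_const
  have h2 := h1.fderiv_of_isOpen (m := ∞) (isOpen_chartTarget x₀) (by simp)
  refine (h2.clm_apply (contDiffOn_const (c := z))).congr fun u hu ↦ ?_
  have hp := chartInv_mem hu
  exact mvfderiv_chartFrame hu (mdiffAt_inner (mdifferentiableAt_chartFrame hp v)
    (mdifferentiableAt_chartFrame hp w)) z

/-- Coordinate fields commute, but the Koszul formula only asks for smoothness of the bracket terms
here. -/
theorem contDiffOn_inner_mlieBracket_chartFrame (x₀ : M) (v w z : E) :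
    ContDiffOn ℝ ∞ (fun u ↦ inner ℝ (VectorField.mlieBracket 𝓘(ℝ, E)
        (fun p ↦ chartFrame x₀ p v) (fun p ↦ chartFrame x₀ p w) (chartInv x₀ u))
        (chartFrame x₀ (chartInv x₀ u) z)) (chartAt E x₀).target := by
  have : CompleteSpace E := FiniteDimensional.complete ℝ E
  have : IsManifold 𝓘(ℝ, E) (minSmoothness ℝ 2) M := by
    rw [minSmoothness_of_isRCLikeNormedField]
    infer_instance
  -- The bracket costs one derivative, and ∞ + 1 is ∞.
  have : IsManifold 𝓘(ℝ, E) (((⊤ : ℕ∞) : ℕ∞ω) + 1) M := inferInstanceAs (IsManifold 𝓘(ℝ, E) ∞ M)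
  have h1 : ContMDiffOn 𝓘(ℝ, E) 𝓘(ℝ, E).tangent ∞
      (fun p ↦ (⟨p, VectorField.mlieBracket 𝓘(ℝ, E)
        (fun p ↦ chartFrame x₀ p v) (fun p ↦ chartFrame x₀ p w) p⟩ : TangentBundle 𝓘(ℝ, E) M))
      (chartAt E x₀).source := fun p hp ↦
    (ContMDiffAt.mlieBracket_vectorField (m := ⊤) (n := ⊤) (contMDiffAt_chartFrame hp v)
      (contMDiffAt_chartFrame hp w) (by simp)).contMDiffWithinAt
  have := ContMDiffOn.inner_bundle (IB := 𝓘(ℝ, E)) (n := ∞) (F := E)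
    (E := fun x : M ↦ TangentSpace 𝓘(ℝ, E) x) (b := fun x : M ↦ x) h1
    (contMDiffOn_chartFrame x₀ z)
  exact contDiffOn_comp_chartInv le_rfl this

theorem contDiffOn_koszul_chartFrame (x₀ : M) (v w z : E) :
    ContDiffOn ℝ ∞ (fun u ↦ koszul (fun p ↦ chartFrame x₀ p v) (fun p ↦ chartFrame x₀ p w)
      (fun p ↦ chartFrame x₀ p z) (chartInv x₀ u)) (chartAt E x₀).target := by
  unfold koszul
  exact ((((contDiffOn_fderiv_inner_chartFrame x₀ w z v).add
    (contDiffOn_fderiv_inner_chartFrame x₀ v z w)).sub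
    (contDiffOn_fderiv_inner_chartFrame x₀ v w z)).add
    (contDiffOn_inner_mlieBracket_chartFrame x₀ v w z)).sub
    (contDiffOn_inner_mlieBracket_chartFrame x₀ v z w) |>.sub
    (contDiffOn_inner_mlieBracket_chartFrame x₀ w z v)

theorem contDiffOn_inverse_chartMetric (x₀ : M) :
    ContDiffOn ℝ ∞ (fun u ↦ (chartMetric x₀ u).inverse) (chartAt E x₀).target := by
  have : CompleteSpace E := FiniteDimensional.complete ℝ E
  intro u hu
  exact ((isInvertible_chartMetric hu).contDiffAt_map_inverse).comp_contDiffWithinAt u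
    (contDiffOn_chartMetric x₀ u hu)

/-- After lowering the index with the metric, the components are half the Koszul expression of
coordinate fields, which is smooth. The smooth inverse metric raises the index again. -/
theorem contDiffOn_chartConnection (x₀ : M) (v : E) :
    ContDiffOn ℝ ∞ (chartConnection x₀ v) (chartAt E x₀).target := by
  refine contDiffOn_clm_apply.2 fun z ↦ ?_
  have h1 : ContDiffOn ℝ ∞ (fun u ↦ chartMetric x₀ u (chartConnection x₀ v u z))
      (chartAt E x₀).target := by
    refine contDiffOn_clm_apply.2 fun w ↦ ?_
    refine (contDiffOn_const (c := (1 / 2 : ℝ)) |>.mul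
      (contDiffOn_koszul_chartFrame x₀ z v w)).congr fun u hu ↦ ?_
    have hp := chartInv_mem hu
    rw [← inner_leviCivitaFun (mdifferentiableAt_chartFrame hp z)
      (mdifferentiableAt_chartFrame hp v) (mdifferentiableAt_chartFrame hp w), chartMetric_apply]
    congr 1
    exact chartFrame_chartCoord hp _
  refine ((contDiffOn_inverse_chartMetric x₀).clm_apply h1).congr fun u hu ↦ ?_
  exact ((isInvertible_chartMetric hu).inverse_apply_eq.2 rfl).symm

theorem contDiffOn_christoffel (x₀ : M) :
    ContDiffOn ℝ ∞ (christoffel x₀) (chartAt E x₀).target := by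
  unfold christoffel
  exact ContDiffOn.sum fun i _ ↦ contDiffOn_const.smulRight (contDiffOn_chartConnection x₀ _)

/-- Differentiability of the sum is carried through the induction because additivity of the
connection requires it of both summands. -/
theorem leviCivita_sum_smul {ι : Type*} (s : Finset ι) {g : ι → M → ℝ}
    {Y : ι → Π p : M, TangentSpace 𝓘(ℝ, E) p} {p : M} (hg : ∀ i, MDiffAt (g i) p)
    (hY : ∀ i, MDiffAt (T% (Y i)) p) :
    MDiffAt (T% (∑ i ∈ s, g i • Y i)) p ∧
    leviCivita E M (∑ i ∈ s, g i • Y i) p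
      = ∑ i ∈ s, (g i p • leviCivita E M (Y i) p
          + (mvfderiv 𝓘(ℝ, E) (g i) p).smulRight (Y i p)) := by
  classical
  have hcov := (leviCivita E M).isCovariantDerivativeOnUniv
  induction s using Finset.induction_on with
  | empty =>
    have h0 : MDiffAt (T% (0 : Π p : M, TangentSpace 𝓘(ℝ, E) p)) p :=
      (contMDiff_zeroSection ℝ (fun p : M ↦ TangentSpace 𝓘(ℝ, E) p) (IB := 𝓘(ℝ, E))
        (n := 1)).contMDiffAt.mdifferentiableAt (by simp)
    refine ⟨by simpa using h0, ?_⟩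
    simp [CovariantDerivative.zero]
  | insert i s hi ih =>
    have h1 : MDiffAt (T% (g i • Y i)) p := (hg i).smul_section (hY i)
    simp only [Finset.sum_insert hi]
    refine ⟨mdifferentiableAt_add_section h1 ih.1, ?_⟩
    have h2 := hcov.add h1 ih.1
    have h3 := hcov.leibniz (hY i) (hg i)
    rw [← ih.2, ← h3]
    exact h2

/-- The Levi-Civita connection in the chart at `x₀`. -/
theorem chartCoord_leviCivita {x₀ : M} {u : E} (hu : u ∈ (chartAt E x₀).target)
    {Y : Π p : M, TangentSpace 𝓘(ℝ, E) p} {η : E → E} (hη : ContDiffAt ℝ 1 η u)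
    (hY : ∀ᶠ w in 𝓝 u, chartCoord x₀ (chartInv x₀ w) (Y (chartInv x₀ w)) = η w) (v : E) :
    chartCoord x₀ (chartInv x₀ u)
        (leviCivita E M Y (chartInv x₀ u) (chartFrame x₀ (chartInv x₀ u) v))
      = fderiv ℝ η u v + christoffel x₀ u (η u) v := by
  set p := chartInv x₀ u with hpdef
  have hp : p ∈ (chartAt E x₀).source := chartInv_mem hu
  have hpu : chartAt E x₀ p = u := (chartAt E x₀).right_inv hu
  set b := Module.finBasis ℝ E
  let g : Fin (Module.finrank ℝ E) → M → ℝ := fun i q ↦ b.coord i (η (chartAt E x₀ q))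
  have hchart : ContMDiffAt 𝓘(ℝ, E) 𝓘(ℝ, E) 1 (chartAt E x₀) p :=
    (contMDiffOn_chart (n := 1)).contMDiffAt ((chartAt E x₀).open_source.mem_nhds hp)
  have hη' : ContMDiffAt 𝓘(ℝ, E) 𝓘(ℝ, E) 1 (fun q ↦ η (chartAt E x₀ q)) p := by
    refine ContMDiffAt.comp p ?_ hchart
    rw [hpu]; exact hη.contMDiffAt
  have hg : ∀ i, MDiffAt (g i) p := fun i ↦ by
    have : ContMDiffAt 𝓘(ℝ, E) 𝓘(ℝ, ℝ) 1 (g i) p :=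
      ((b.coord i).toContinuousLinearMap.contDiff.contMDiff.contMDiffAt).comp p hη'
    exact this.mdifferentiableAt (by simp)
  have hF : ∀ i, MDiffAt (T% (fun q : M ↦ chartFrame x₀ q (b i))) p := fun i ↦
    mdifferentiableAt_chartFrame hp _
  obtain ⟨hd, hs⟩ := leviCivita_sum_smul Finset.univ hg hF
  have hev : ∀ᶠ q in 𝓝 p, chartCoord x₀ q (Y q) = η (chartAt E x₀ q) := by
    have hc : ContinuousAt (chartAt E x₀) p := (chartAt E x₀).continuousAt hp
    have h1 : Tendsto (chartAt E x₀) (𝓝 p) (𝓝 u) := by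
      have := hc.tendsto; rwa [hpu] at this
    filter_upwards [h1.eventually hY, (chartAt E x₀).open_source.mem_nhds hp] with q hq hqs
    have h2 : chartInv x₀ (chartAt E x₀ q) = q := (chartAt E x₀).left_inv hqs
    rwa [h2] at hq
  -- Near p the field is a combination of coordinate fields. The connection at p depends only on the
  -- germ of the field, so the Leibniz rule for this sum gives the derivative of the coefficients
  -- plus the Christoffel term.
  have heq : ∀ᶠ q in 𝓝 p, Y q = (∑ i, g i • fun q : M ↦ chartFrame x₀ q (b i)) q := by
    filter_upwards [hev, (chartAt E x₀).open_source.mem_nhds hp] with q hq hqs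
    rw [← chartFrame_chartCoord hqs (Y q), hq]
    refine (congrArg (chartFrame x₀ q) (b.sum_repr (η (chartAt E x₀ q))).symm).trans ?_
    rw [map_sum, Finset.sum_apply]
    exact Finset.sum_congr rfl fun i _ ↦ map_smul _ _ _
  have hYd : MDiffAt (T% Y) p := by
    have := ((trivializationAt E (TangentSpace 𝓘(ℝ, E)) x₀).contMDiffAt_section_iff
      (IB := 𝓘(ℝ, E)) (n := 1) (s := Y) hp).2 (hη'.congr_of_eventuallyEq ?_)
    · exact this.mdifferentiableAt (by simp)
    · filter_upwards [hev, (chartAt E x₀).open_source.mem_nhds hp] with q hq hqs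
      rw [← hq, chartCoord_eq hqs]
  have hcov := (leviCivita E M).isCovariantDerivativeOnUniv
  have h1 : leviCivita E M Y p = _ := hcov.congr_of_eventuallyEq hYd hd univ_mem heq
  rw [h1]
  change chartCoord x₀ p (leviCivita E M _ p _) = _
  rw [hs]
  have hgd : ∀ i, mvfderiv 𝓘(ℝ, E) (g i) p (chartFrame x₀ p v) = b.coord i (fderiv ℝ η u v) := by
    intro i
    have h2 := mvfderiv_chartFrame hu (hg i) v
    have h3 : (fun w ↦ g i (chartInv x₀ w)) =ᶠ[𝓝 u]
        fun w ↦ (b.coord i).toContinuousLinearMap (η w) := by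
      filter_upwards [(isOpen_chartTarget x₀).mem_nhds hu] with w hw
      have : chartAt E x₀ (chartInv x₀ w) = w := (chartAt E x₀).right_inv hw
      simp [g, this]
    have hηd : DifferentiableAt ℝ η u := hη.differentiableAt (by simp)
    have h4 : fderiv ℝ (fun w ↦ (b.coord i).toContinuousLinearMap (η w)) u
        = (b.coord i).toContinuousLinearMap.comp (fderiv ℝ η u) :=
      ((b.coord i).toContinuousLinearMap.hasFDerivAt.comp u hηd.hasFDerivAt).fderiv
    rw [h3.fderiv_eq, h4] at h2
    exact h2
  have h5 : fderiv ℝ η u v = ∑ i, b.coord i (fderiv ℝ η u v) • b i := (b.sum_repr _).symm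
  have h6 : christoffel x₀ u (η u) v
      = ∑ i, b.coord i (η u) • chartCoord x₀ p (leviCivita E M (fun q ↦ chartFrame x₀ q (b i)) p
          (chartFrame x₀ p v)) := by
    simp only [christoffel, sum_apply]
    rfl
  rw [h5, h6, ← Finset.sum_add_distrib, sum_apply, map_sum]
  refine Finset.sum_congr rfl fun i _ ↦ ?_
  have h7 : g i p = b.coord i (η u) := by simp only [g, hpu]
  rw [← hgd i, ← h7, add_comm]
  simp only [add_apply, smul_apply, map_add, map_smul, ContinuousLinearMap.smulRight_apply,
    chartCoord_chartFrame hp]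

end Hessian

/-! ### Gradient, Hessian, Newton and prediction vectors in a chart -/

section Newton

variable {E : Type*} [NormedAddCommGroup E] [NormedSpace ℝ E] [FiniteDimensional ℝ E]
  {M : Type*} [TopologicalSpace M] [ChartedSpace E M] [IsManifold 𝓘(ℝ, E) ∞ M]
  [RiemannianBundle (fun x : M ↦ TangentSpace 𝓘(ℝ, E) x)]
  [IsContMDiffRiemannianBundle 𝓘(ℝ, E) ∞ E (fun x : M ↦ TangentSpace 𝓘(ℝ, E) x)]

/-- The function `f` in the chart at `x₀`. -/
def chartFun (f : M × ℝ → ℝ) (x₀ : M) (q : E × ℝ) : ℝ := f (chartInv x₀ q.1, q.2)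

/-- The open subset of `E × ℝ` that corresponds to `V` in the chart at `x₀`. -/
def chartDomain (V : Set (M × ℝ)) (x₀ : M) : Set (E × ℝ) :=
  {q | q.1 ∈ (chartAt E x₀).target ∧ (chartInv x₀ q.1, q.2) ∈ V}

/-- The gradient of `f` in the chart at `x₀`. -/
def chartGrad (f : M × ℝ → ℝ) (x₀ : M) (q : E × ℝ) : E :=
  (chartMetric x₀ q.1).inverse ((fderiv ℝ (chartFun f x₀) q).comp (.inl ℝ E ℝ))

/-- The Hessian of `f` in the chart at `x₀`. -/
def chartHess (f : M × ℝ → ℝ) (x₀ : M) (q : E × ℝ) : E →L[ℝ] E :=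
  (fderiv ℝ (chartGrad f x₀) q).comp (.inl ℝ E ℝ) + christoffel x₀ q.1 (chartGrad f x₀ q)

theorem contMDiffOn_chartInv_prod (x₀ : M) :
    ContMDiffOn 𝓘(ℝ, E × ℝ) (𝓘(ℝ, E).prod 𝓘(ℝ, ℝ)) ∞
      (fun q : E × ℝ ↦ (chartInv x₀ q.1, q.2)) {q | q.1 ∈ (chartAt E x₀).target} :=
  ((contMDiffOn_chartInv x₀).comp contDiff_fst.contMDiff.contMDiffOn fun _ hq ↦ hq).prodMk
    contDiff_snd.contMDiff.contMDiffOn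

theorem isOpen_chartDomain {V : Set (M × ℝ)} (hV : IsOpen V) (x₀ : M) :
    IsOpen (chartDomain (E := E) V x₀) :=
  (contMDiffOn_chartInv_prod x₀).continuousOn.isOpen_inter_preimage
    ((isOpen_chartTarget x₀).preimage continuous_fst) hV

variable {V : Set (M × ℝ)} {f : M × ℝ → ℝ}

theorem contDiffOn_chartFun (hf : ContMDiffOn (𝓘(ℝ, E).prod 𝓘(ℝ, ℝ)) 𝓘(ℝ, ℝ) 4 f V) (x₀ : M) :
    ContDiffOn ℝ 4 (chartFun f x₀) (chartDomain (E := E) V x₀) :=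
  contMDiffOn_iff_contDiffOn.1 (hf.comp
    (((contMDiffOn_chartInv_prod x₀).of_le ENat.LEInfty.out).mono fun _ hq ↦ hq.1)
    fun _ hq ↦ hq.2)

theorem contDiffOn_chartGrad (hV : IsOpen V)
    (hf : ContMDiffOn (𝓘(ℝ, E).prod 𝓘(ℝ, ℝ)) 𝓘(ℝ, ℝ) 4 f V) (x₀ : M) :
    ContDiffOn ℝ 3 (chartGrad f x₀) (chartDomain (E := E) V x₀) := by
  have h1 := (contDiffOn_chartFun hf x₀).fderiv_of_isOpen (m := 3) (isOpen_chartDomain hV x₀)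
    (by norm_num)
  have h2 : ContDiffOn ℝ 3 (fun q : E × ℝ ↦ (chartMetric x₀ q.1).inverse)
      (chartDomain (E := E) V x₀) :=
    ((contDiffOn_inverse_chartMetric x₀).of_le ENat.LEInfty.out).comp
      contDiff_fst.contDiffOn fun _ hq ↦ hq.1
  exact h2.clm_apply (h1.clm_comp contDiffOn_const)

/-- The gradient and the Hessian lose one derivative of f each, from 4 to 3 to 2; the inverse metric
and the Christoffel symbols are smooth and cost none. -/
theorem contDiffOn_chartHess (hV : IsOpen V)
    (hf : ContMDiffOn (𝓘(ℝ, E).prod 𝓘(ℝ, ℝ)) 𝓘(ℝ, ℝ) 4 f V) (x₀ : M) :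
    ContDiffOn ℝ 2 (chartHess f x₀) (chartDomain (E := E) V x₀) := by
  have h0 := contDiffOn_chartGrad hV hf x₀
  have h1 := h0.fderiv_of_isOpen (m := 2) (isOpen_chartDomain hV x₀) (by norm_num)
  have h2 : ContDiffOn ℝ 2 (fun q : E × ℝ ↦ christoffel x₀ q.1) (chartDomain (E := E) V x₀) :=
    ((contDiffOn_christoffel x₀).of_le ENat.LEInfty.out).comp
      contDiff_fst.contDiffOn fun _ hq ↦ hq.1
  exact (h1.clm_comp contDiffOn_const).add (h2.clm_apply (h0.of_le (by norm_num)))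

theorem fderiv_comp_prodMk_left {F : Type*} [NormedAddCommGroup F] [NormedSpace ℝ F]
    {g : E × ℝ → F} {u : E} {l : ℝ} (hg : DifferentiableAt ℝ g (u, l)) :
    fderiv ℝ (fun w ↦ g (w, l)) u = (fderiv ℝ g (u, l)).comp (.inl ℝ E ℝ) :=
  (hg.hasFDerivAt.comp u (hasFDerivAt_prodMk_left u l)).fderiv

theorem chartCoord_grad (hV : IsOpen V)
    (hf : ContMDiffOn (𝓘(ℝ, E).prod 𝓘(ℝ, ℝ)) 𝓘(ℝ, ℝ) 4 f V) {x₀ : M} {u : E} {l : ℝ}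
    (hq : (u, l) ∈ chartDomain V x₀) :
    chartCoord x₀ (chartInv x₀ u) (grad E (fun p ↦ f (p, l)) (chartInv x₀ u))
      = chartGrad f x₀ (u, l) := by
  have hp := chartInv_mem hq.1
  refine ((isInvertible_chartMetric hq.1).inverse_apply_eq.2 ?_).symm
  ext w
  rw [chartMetric_apply, chartFrame_chartCoord hp, grad, InnerProductSpace.toDual_symm_apply]
  have hfd : ContMDiffAt 𝓘(ℝ, E) 𝓘(ℝ, ℝ) 4 (fun p ↦ f (p, l)) (chartInv x₀ u) :=
    ContMDiffAt.comp (I' := 𝓘(ℝ, E).prod 𝓘(ℝ, ℝ)) (g := f) (f := fun p : M ↦ (p, l)) _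
      (hf.contMDiffAt (hV.mem_nhds hq.2)) (contMDiffAt_id.prodMk contMDiffAt_const)
  rw [mvfderiv_chartFrame hq.1 (hfd.mdifferentiableAt (by simp))]
  have := fderiv_comp_prodMk_left (((contDiffOn_chartFun hf x₀).contDiffAt
    ((isOpen_chartDomain hV x₀).mem_nhds hq)).differentiableAt (by simp))
  exact (DFunLike.congr_fun this w).symm

theorem chartCoord_hess (hV : IsOpen V)
    (hf : ContMDiffOn (𝓘(ℝ, E).prod 𝓘(ℝ, ℝ)) 𝓘(ℝ, ℝ) 4 f V) {x₀ : M} {u : E} {l : ℝ}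
    (hq : (u, l) ∈ chartDomain V x₀) (v : E) :
    chartCoord x₀ (chartInv x₀ u) (hess E (fun p ↦ f (p, l)) (chartInv x₀ u)
        (chartFrame x₀ (chartInv x₀ u) v)) = chartHess f x₀ (u, l) v := by
  have hg : ContDiffAt ℝ 3 (chartGrad f x₀) (u, l) :=
    (contDiffOn_chartGrad hV hf x₀).contDiffAt ((isOpen_chartDomain hV x₀).mem_nhds hq)
  have hη : ContDiffAt ℝ 1 (fun w ↦ chartGrad f x₀ (w, l)) u :=
    ContDiffAt.comp u (hg.of_le (by norm_num)) (contDiffAt_id.prodMk contDiffAt_const)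
  have hY : ∀ᶠ w in 𝓝 u, chartCoord x₀ (chartInv x₀ w)
      (grad E (fun p ↦ f (p, l)) (chartInv x₀ w)) = chartGrad f x₀ (w, l) := by
    have hc : Continuous fun w : E ↦ (w, l) := by fun_prop
    filter_upwards [hc.continuousAt.preimage_mem_nhds
      ((isOpen_chartDomain hV x₀).mem_nhds hq)] with w hw
    exact chartCoord_grad hV hf hw
  have := chartCoord_leviCivita hq.1 hη hY v
  rw [fderiv_comp_prodMk_left (hg.differentiableAt (by simp))] at this
  exact this

theorem hess_eq (hV : IsOpen V)
    (hf : ContMDiffOn (𝓘(ℝ, E).prod 𝓘(ℝ, ℝ)) 𝓘(ℝ, ℝ) 4 f V) {x₀ : M} {u : E} {l : ℝ}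
    (hq : (u, l) ∈ chartDomain V x₀) :
    hess E (fun p ↦ f (p, l)) (chartInv x₀ u)
      = ((chartEquiv (chartInv_mem hq.1)).symm : E →L[ℝ] TangentSpace 𝓘(ℝ, E) (chartInv x₀ u)).comp
        ((chartHess f x₀ (u, l)).comp (chartEquiv (chartInv_mem hq.1) :
          TangentSpace 𝓘(ℝ, E) (chartInv x₀ u) →L[ℝ] E)) := by
  have hp := chartInv_mem hq.1
  ext v
  change _ = chartFrame x₀ (chartInv x₀ u) (chartHess f x₀ (u, l) (chartCoord x₀ _ v))
  rw [← chartCoord_hess hV hf hq, chartFrame_chartCoord hp, chartFrame_chartCoord hp]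

/-- The two Hessians are conjugate by the chart isomorphism. Invertibility is not required, since
`inverse` is 0 on both sides when it fails. -/
theorem chartCoord_inverse_hess (hV : IsOpen V)
    (hf : ContMDiffOn (𝓘(ℝ, E).prod 𝓘(ℝ, ℝ)) 𝓘(ℝ, ℝ) 4 f V) {x₀ : M} {u : E} {l : ℝ}
    (hq : (u, l) ∈ chartDomain V x₀) (v : TangentSpace 𝓘(ℝ, E) (chartInv x₀ u)) :
    chartCoord x₀ (chartInv x₀ u) ((hess E (fun p ↦ f (p, l)) (chartInv x₀ u)).inverse v)
      = (chartHess f x₀ (u, l)).inverse (chartCoord x₀ (chartInv x₀ u) v) := by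
  have hp := chartInv_mem hq.1
  rw [hess_eq hV hf hq, ContinuousLinearMap.inverse_equiv_comp,
    ContinuousLinearMap.inverse_comp_equiv]
  exact chartCoord_chartFrame hp _

theorem isInvertible_chartHess (hV : IsOpen V)
    (hf : ContMDiffOn (𝓘(ℝ, E).prod 𝓘(ℝ, ℝ)) 𝓘(ℝ, ℝ) 4 f V) {x₀ : M} {u : E} {l : ℝ}
    (hq : (u, l) ∈ chartDomain V x₀)
    (h : (hess E (fun p ↦ f (p, l)) (chartInv x₀ u)).IsInvertible) :
    (chartHess f x₀ (u, l)).IsInvertible := by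
  rw [hess_eq hV hf hq] at h
  simpa using h

/-- The Newton update vector in the chart at `x₀`. -/
def chartNewton (f : M × ℝ → ℝ) (x₀ : M) (q : E × ℝ) : E :=
  -(chartHess f x₀ q).inverse (chartGrad f x₀ q)

/-- The prediction vector in the chart at `x₀`. -/
def chartPrediction (f : M × ℝ → ℝ) (x₀ : M) (q : E × ℝ) : E :=
  -(chartHess f x₀ q).inverse (fderiv ℝ (chartGrad f x₀) q (0, 1))

theorem chartCoord_newtonVector (hV : IsOpen V)
    (hf : ContMDiffOn (𝓘(ℝ, E).prod 𝓘(ℝ, ℝ)) 𝓘(ℝ, ℝ) 4 f V) {x₀ : M} {u : E} {l : ℝ}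
    (hq : (u, l) ∈ chartDomain V x₀) :
    chartCoord x₀ (chartInv x₀ u) (newtonVector E f (chartInv x₀ u) l)
      = chartNewton f x₀ (u, l) := by
  rw [newtonVector, map_neg, chartCoord_inverse_hess hV hf hq, chartCoord_grad hV hf hq,
    chartNewton]

theorem chartCoord_gradParamDeriv (hV : IsOpen V)
    (hf : ContMDiffOn (𝓘(ℝ, E).prod 𝓘(ℝ, ℝ)) 𝓘(ℝ, ℝ) 4 f V) {x₀ : M} {u : E} {l : ℝ}
    (hq : (u, l) ∈ chartDomain V x₀) :
    chartCoord x₀ (chartInv x₀ u) (gradParamDeriv E f (chartInv x₀ u) l)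
      = fderiv ℝ (chartGrad f x₀) (u, l) (0, 1) := by
  have hp := chartInv_mem hq.1
  have hg : DifferentiableAt ℝ (chartGrad f x₀) (u, l) :=
    ((contDiffOn_chartGrad hV hf x₀).contDiffAt
      ((isOpen_chartDomain hV x₀).mem_nhds hq)).differentiableAt (by simp)
  have h1 : HasDerivAt (fun μ ↦ chartGrad f x₀ (u, μ)) (fderiv ℝ (chartGrad f x₀) (u, l) (0, 1)) l :=
    hg.hasFDerivAt.comp_hasDerivAt l ((hasDerivAt_const l u).prodMk (hasDerivAt_id l))
  have h2 : HasDerivAt (fun μ ↦ chartFrame x₀ (chartInv x₀ u) (chartGrad f x₀ (u, μ)))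
      (chartFrame x₀ (chartInv x₀ u) (fderiv ℝ (chartGrad f x₀) (u, l) (0, 1))) l :=
    -- The base point is fixed, so the frame is one continuous linear map. The spaces are named
    -- because the tangent space carries the Riemannian norm, which is not the norm of E.
    HasFDerivAt.comp_hasDerivAt (E := TangentSpace 𝓘(ℝ, E) (chartInv x₀ u)) (F := E) l
      (chartFrame x₀ (chartInv x₀ u)).hasFDerivAt h1
  have h3 : (fun μ ↦ grad E (fun p ↦ f (p, μ)) (chartInv x₀ u)) =ᶠ[𝓝 l]
      fun μ ↦ chartFrame x₀ (chartInv x₀ u) (chartGrad f x₀ (u, μ)) := by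
    have hc : Continuous fun μ : ℝ ↦ (u, μ) := by fun_prop
    filter_upwards [hc.continuousAt.preimage_mem_nhds
      ((isOpen_chartDomain hV x₀).mem_nhds hq)] with μ hμ
    rw [← chartCoord_grad hV hf hμ, chartFrame_chartCoord hp]
  rw [gradParamDeriv, (h2.congr_of_eventuallyEq h3).deriv, chartCoord_chartFrame hp]

theorem chartCoord_predictionVector (hV : IsOpen V)
    (hf : ContMDiffOn (𝓘(ℝ, E).prod 𝓘(ℝ, ℝ)) 𝓘(ℝ, ℝ) 4 f V) {x₀ : M} {u : E} {l : ℝ}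
    (hq : (u, l) ∈ chartDomain V x₀) :
    chartCoord x₀ (chartInv x₀ u) (predictionVector E f (chartInv x₀ u) l)
      = chartPrediction f x₀ (u, l) := by
  rw [predictionVector, map_neg, chartCoord_inverse_hess hV hf hq,
    chartCoord_gradParamDeriv hV hf hq, chartPrediction]

theorem contDiffAt_inverse_chartHess (hV : IsOpen V)
    (hf : ContMDiffOn (𝓘(ℝ, E).prod 𝓘(ℝ, ℝ)) 𝓘(ℝ, ℝ) 4 f V) {x₀ : M} {q : E × ℝ}
    (hq : q ∈ chartDomain V x₀) (h : (chartHess f x₀ q).IsInvertible) :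
    ContDiffAt ℝ 2 (fun q ↦ (chartHess f x₀ q).inverse) q := by
  have : CompleteSpace E := FiniteDimensional.complete ℝ E
  exact h.contDiffAt_map_inverse.comp q ((contDiffOn_chartHess hV hf x₀).contDiffAt
    ((isOpen_chartDomain hV x₀).mem_nhds hq))

/-- Both factors are of class C²: the inverse Hessian, and the parameter derivative of the C³
gradient. -/
theorem contDiffAt_chartPrediction (hV : IsOpen V)
    (hf : ContMDiffOn (𝓘(ℝ, E).prod 𝓘(ℝ, ℝ)) 𝓘(ℝ, ℝ) 4 f V) {x₀ : M} {q : E × ℝ}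
    (hq : q ∈ chartDomain V x₀) (h : (chartHess f x₀ q).IsInvertible) :
    ContDiffAt ℝ 2 (chartPrediction f x₀) q := by
  have h1 : ContDiffAt ℝ 2 (fderiv ℝ (chartGrad f x₀)) q :=
    ((contDiffOn_chartGrad hV hf x₀).contDiffAt
      ((isOpen_chartDomain hV x₀).mem_nhds hq)).fderiv_right (by norm_num)
  exact ((contDiffAt_inverse_chartHess hV hf hq h).clm_apply
    (h1.clm_apply contDiffAt_const)).neg

theorem norm_eq_sqrt_chartMetric {x₀ : M} {u : E} (hu : u ∈ (chartAt E x₀).target)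
    (v : TangentSpace 𝓘(ℝ, E) (chartInv x₀ u)) :
    ‖v‖ = √(chartMetric x₀ u (chartCoord x₀ _ v) (chartCoord x₀ _ v)) := by
  rw [chartMetric_apply, chartFrame_chartCoord (chartInv_mem hu), real_inner_self_eq_norm_sq,
    Real.sqrt_sq (norm_nonneg _)]

end Newton

/-! ### The retraction in a chart -/

section ChartRetraction

variable {E : Type*} [NormedAddCommGroup E] [NormedSpace ℝ E]
  {M : Type*} [TopologicalSpace M] [ChartedSpace E M] [IsManifold 𝓘(ℝ, E) ∞ M]

/-- The vector of `TM` with coordinates `(u, v)` in the chart at `x₀`. -/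
def chartVector (x₀ : M) (q : E × E) : TangentBundle 𝓘(ℝ, E) M :=
  ⟨chartInv x₀ q.1, chartFrame x₀ (chartInv x₀ q.1) q.2⟩

theorem contMDiffOn_chartVector (x₀ : M) :
    ContMDiffOn 𝓘(ℝ, E × E) 𝓘(ℝ, E).tangent ∞ (chartVector x₀)
      {q : E × E | q.1 ∈ (chartAt E x₀).target} := by
  refine ((trivializationAt E (TangentSpace 𝓘(ℝ, E)) x₀).contMDiffOn_iff
    (IB := 𝓘(ℝ, E)) (n := ∞) (f := chartVector x₀) ?_).2 ⟨?_, ?_⟩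
  · intro q hq
    exact (Trivialization.mem_source _).2 (chartInv_mem hq)
  · exact (contMDiffOn_chartInv x₀).comp contDiff_fst.contMDiff.contMDiffOn fun _ hq ↦ hq
  · refine contDiff_snd.contMDiff.contMDiffOn.congr fun q hq ↦ ?_
    exact (chartCoord_eq (chartInv_mem hq) _).symm.trans
      (chartCoord_chartFrame (chartInv_mem hq) _)

theorem contMDiffAt_chartVector {x₀ : M} {q : E × E} (hq : q.1 ∈ (chartAt E x₀).target) :
    ContMDiffAt 𝓘(ℝ, E × E) 𝓘(ℝ, E).tangent ∞ (chartVector x₀) q :=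
  (contMDiffOn_chartVector x₀).contMDiffAt
    (((isOpen_chartTarget x₀).preimage continuous_fst).mem_nhds hq)

/-- The retraction `R` in the chart at `x₀`. -/
def chartRetraction (R : TangentBundle 𝓘(ℝ, E) M → M) (x₀ : M) (q : E × E) : E :=
  chartAt E x₀ (R (chartVector x₀ q))

variable {R : TangentBundle 𝓘(ℝ, E) M → M}

theorem IsRetraction.map_chartVector_zero (hR : IsRetraction R) (x₀ : M) (u : E) :
    R (chartVector x₀ (u, 0)) = chartInv x₀ u := by
  have : chartVector x₀ (u, 0) = ⟨chartInv x₀ u, 0⟩ := by simp [chartVector]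
  rw [this, hR.map_zero]

theorem IsRetraction.chartRetraction_zero (hR : IsRetraction R) {x₀ : M} {u : E}
    (hu : u ∈ (chartAt E x₀).target) : chartRetraction R x₀ (u, 0) = u := by
  rw [chartRetraction, hR.map_chartVector_zero]
  exact (chartAt E x₀).right_inv hu

theorem IsRetraction.contMDiffAt_comp_chartVector (hR : IsRetraction R) {x₀ : M} {q : E × E}
    (hq : q.1 ∈ (chartAt E x₀).target) :
    ContMDiffAt 𝓘(ℝ, E × E) 𝓘(ℝ, E) ∞ (fun q ↦ R (chartVector x₀ q)) q :=
  ContMDiffAt.comp q hR.contMDiff.contMDiffAt (contMDiffAt_chartVector hq)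

theorem IsRetraction.eventually_mem_source (hR : IsRetraction R) {x₀ : M} {u : E}
    (hu : u ∈ (chartAt E x₀).target) :
    ∀ᶠ q in 𝓝 (u, (0 : E)), R (chartVector x₀ q) ∈ (chartAt E x₀).source := by
  have h := (hR.contMDiffAt_comp_chartVector (q := (u, (0 : E))) hu).continuousAt
  refine h.preimage_mem_nhds ((chartAt E x₀).open_source.mem_nhds ?_)
  rw [hR.map_chartVector_zero]
  exact chartInv_mem hu

theorem IsRetraction.contDiffAt_chartRetraction (hR : IsRetraction R) {x₀ : M} {u : E}
    (hu : u ∈ (chartAt E x₀).target) : ContDiffAt ℝ ∞ (chartRetraction R x₀) (u, 0) := by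
  refine contMDiffAt_iff_contDiffAt.1 (ContMDiffAt.comp (g := chartAt E x₀) (I' := 𝓘(ℝ, E)) _ ?_
    (hR.contMDiffAt_comp_chartVector hu))
  refine contMDiffOn_chart.contMDiffAt ((chartAt E x₀).open_source.mem_nhds ?_)
  rw [hR.map_chartVector_zero]
  exact chartInv_mem hu

/-- By the chain rule the derivative is the coordinate map at p after D R_p(0) = id after the frame
at p, and these two are mutually inverse. -/
theorem IsRetraction.hasFDerivAt_chartRetraction (hR : IsRetraction R) {x₀ : M} {u : E}
    (hu : u ∈ (chartAt E x₀).target) :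
    HasFDerivAt (fun v ↦ chartRetraction R x₀ (u, v)) (ContinuousLinearMap.id ℝ E) 0 := by
  set p := chartInv x₀ u with hpdef
  have hp : p ∈ (chartAt E x₀).source := chartInv_mem hu
  have h1 : HasMFDerivAt 𝓘(ℝ, E) 𝓘(ℝ, E) (chartAt E x₀) p
      (chartCoord (E := E) x₀ p : TangentSpace 𝓘(ℝ, E) p →L[ℝ] E) := by
    rw [← mfderiv_chart hp]
    have : ContMDiffAt 𝓘(ℝ, E) 𝓘(ℝ, E) 1 (chartAt E x₀) p :=
      (contMDiffOn_chart (n := 1)).contMDiffAt ((chartAt E x₀).open_source.mem_nhds hp)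
    exact (this.mdifferentiableAt (by simp)).hasMFDerivAt
  have h2 := hR.hasMFDerivAt_zero p
  have h3 : HasMFDerivAt 𝓘(ℝ, E) 𝓘(ℝ, E) (chartAt E x₀) (R ⟨p, (0 : E)⟩)
      ((chartCoord (E := E) x₀ p : TangentSpace 𝓘(ℝ, E) p →L[ℝ] E) : E →L[ℝ] E) := by
    have h4 : R ⟨p, (0 : E)⟩ = p := hR.map_zero p
    rw [h4]; exact h1
  have h5 : HasFDerivAt (fun v : E ↦ chartAt E x₀ (R ⟨p, v⟩))
      ((chartCoord (E := E) x₀ p : TangentSpace 𝓘(ℝ, E) p →L[ℝ] E) : E →L[ℝ] E) 0 :=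
    hasMFDerivAt_iff_hasFDerivAt.1 (HasMFDerivAt.comp (0 : E) h3 h2)
  -- The tangent space unfolds to E, so the frame is an endomorphism of E and the chain rule applies
  -- within the model space.
  let L : E →L[ℝ] E := (chartFrame (E := E) x₀ p : E →L[ℝ] TangentSpace 𝓘(ℝ, E) p)
  have hL0 : L 0 = 0 := _root_.map_zero L
  have h6 : HasFDerivAt L L 0 := L.hasFDerivAt
  have h7 := HasFDerivAt.comp (0 : E) (g := fun v : E ↦ chartAt E x₀ (R ⟨p, v⟩)) (f := L)
    (by rw [hL0]; exact h5) h6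
  refine HasFDerivAt.congr_fderiv h7 ?_
  ext v
  exact chartCoord_chartFrame hp v

end ChartRetraction

/-! ### The vector transport along a curve -/

section ChartTransport

variable {E : Type*} [NormedAddCommGroup E] [NormedSpace ℝ E]
  {M : Type*} [TopologicalSpace M] [ChartedSpace E M] [IsManifold 𝓘(ℝ, E) ∞ M]
  [RiemannianBundle (fun x : M ↦ TangentSpace 𝓘(ℝ, E) x)]

/-- Smoothness of a transport is a statement about maps into TM. Its fibre component is
differentiated in the trivialization at x₀, and the fixed linear frame at x₀ carries the result back
to T_{x₀}M with its Riemannian norm. -/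
theorem IsVectorTransport.contDiffAt_comp
    {T : Π y x : M, TangentSpace 𝓘(ℝ, E) y →L[ℝ] TangentSpace 𝓘(ℝ, E) x}
    (hT : IsVectorTransport T) {x₀ : M} {c : ℝ → E × E} (hc : ContDiffAt ℝ 2 c 0)
    (hc0 : (c 0).1 = chartAt E x₀ x₀) :
    ContDiffAt ℝ 2 (fun h ↦ T (chartInv x₀ (c h).1) x₀
      (chartFrame x₀ (chartInv x₀ (c h).1) (c h).2)) 0 := by
  have hx₀ : x₀ ∈ (chartAt E x₀).source := mem_chart_source E x₀
  have hu : (c 0).1 ∈ (chartAt E x₀).target := hc0 ▸ mem_chart_target E x₀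
  have hp : chartInv x₀ (c 0).1 = x₀ := by
    rw [hc0]; exact (chartAt E x₀).left_inv hx₀
  have h1 : ContMDiffAt 𝓘(ℝ, ℝ) 𝓘(ℝ, E).tangent 2 (fun h ↦ chartVector x₀ (c h)) 0 :=
    ContMDiffAt.comp (0 : ℝ) ((contMDiffAt_chartVector hu).of_le ENat.LEInfty.out)
      hc.contMDiffAt
  -- The base point of the curve at 0 equals x₀ only propositionally; an existential over T_{x₀}M
  -- avoids a cast between tangent spaces.
  have h2 : ∃ v : TangentSpace 𝓘(ℝ, E) x₀, chartVector x₀ (c 0) = ⟨x₀, v⟩ := by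
    unfold chartVector
    rw [hp]
    exact ⟨_, rfl⟩
  obtain ⟨v, hv⟩ := h2
  have h3 := (hT.contMDiffAt x₀ v).of_le (n := ∞) (m := 2) ENat.LEInfty.out
  rw [← hv] at h3
  have h4 := ContMDiffAt.comp (0 : ℝ) (f := fun h ↦ (chartVector x₀ (c h), x₀)) h3
    (h1.prodMk contMDiffAt_const)
  have h5 := (contMDiffAt_totalSpace.1 h4).2
  have h6 : ContDiffAt ℝ 2 (fun h ↦ chartCoord x₀ x₀ (T (chartInv x₀ (c h).1) x₀
      (chartFrame x₀ (chartInv x₀ (c h).1) (c h).2))) 0 := by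
    refine contMDiffAt_iff_contDiffAt.1 (h5.congr_of_eventuallyEq (.of_eq ?_))
    ext h
    exact chartCoord_eq hx₀ _
  have h7 : ContDiffAt ℝ 2 (fun h ↦ chartFrame x₀ x₀ (chartCoord x₀ x₀ (T (chartInv x₀ (c h).1) x₀
      (chartFrame x₀ (chartInv x₀ (c h).1) (c h).2)))) 0 :=
    ContDiffAt.comp (F := E) (G := TangentSpace 𝓘(ℝ, E) x₀) 0
      (g := fun v ↦ chartFrame x₀ x₀ v) (ContinuousLinearMap.contDiff (E := E)
        (F := TangentSpace 𝓘(ℝ, E) x₀) (chartFrame x₀ x₀)).contDiffAt h6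
  refine h7.congr_of_eventuallyEq (.of_eq ?_)
  ext h
  exact (chartFrame_chartCoord hx₀ _).symm

end ChartTransport

/-! ### One-sided asymptotic expansions in normed spaces -/

section Expansion

variable {E F : Type*} [NormedAddCommGroup E] [NormedSpace ℝ E]
  [NormedAddCommGroup F] [NormedSpace ℝ F]

/-- A shortcut instance. -/
instance normedAddCommGroupBilinear : NormedAddCommGroup (E →L[ℝ] E →L[ℝ] F) :=
  ContinuousLinearMap.toNormedAddCommGroup

theorem exists_contDiffOn_Icc {g : ℝ → F} {n : ℕ} (hg : ContDiffAt ℝ n g 0) :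
    ∃ ε > 0, ContDiffOn ℝ n g (Icc 0 ε) := by
  obtain ⟨u, hu, h⟩ := hg.contDiffOn (m := n) le_rfl (by simp)
  obtain ⟨ε, hε, hb⟩ := Metric.mem_nhds_iff.1 hu
  refine ⟨ε / 2, half_pos hε, h.mono fun x hx ↦ hb ?_⟩
  rw [Metric.mem_ball, dist_zero_right, Real.norm_eq_abs, abs_of_nonneg hx.1]
  linarith [hx.2]

theorem isBigO_sub_taylorWithinEval {g : ℝ → F} {n : ℕ} {ε : ℝ} (hε : 0 < ε)
    (hg : ContDiffOn ℝ (n + 1) g (Icc 0 ε)) :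
    (fun h ↦ g h - taylorWithinEval g n (Icc 0 ε) 0 h) =O[𝓝[≥] 0] fun h ↦ h ^ (n + 1) := by
  obtain ⟨C, hC⟩ := exists_taylor_mean_remainder_bound hε.le hg
  refine IsBigO.of_bound C ?_
  filter_upwards [Icc_mem_nhdsGE hε] with h hh
  refine (hC h hh).trans_eq ?_
  rw [sub_zero, Real.norm_of_nonneg (pow_nonneg hh.1 _)]

theorem derivWithin_Icc_zero {g : ℝ → F} {ε : ℝ} (hε : 0 < ε) (hg : DifferentiableAt ℝ g 0) :
    derivWithin g (Icc 0 ε) 0 = deriv g 0 :=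
  hg.derivWithin ((uniqueDiffOn_Icc hε) 0 ⟨le_rfl, hε.le⟩)

theorem isBigO_sub_taylor_one {g : ℝ → F} (hg : ContDiffAt ℝ 2 g 0) :
    (fun h ↦ g h - g 0 - h • deriv g 0) =O[𝓝[≥] 0] fun h ↦ h ^ 2 := by
  obtain ⟨ε, hε, h⟩ := exists_contDiffOn_Icc (n := 2) hg
  refine (isBigO_sub_taylorWithinEval (n := 1) hε (by exact_mod_cast h)).congr_left fun h ↦ ?_
  simp [taylorWithinEval_succ, derivWithin_Icc_zero hε (hg.differentiableAt (by simp))]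
  abel

theorem exists_isBigO_sub_sq_smul {g : ℝ → F} (hg : ContDiffAt ℝ 3 g 0) (h0 : g 0 = 0)
    (h1 : deriv g 0 = 0) :
    ∃ a : F, (fun h ↦ g h - h ^ 2 • a) =O[𝓝[>] 0] fun h ↦ h ^ 3 := by
  obtain ⟨ε, hε, h⟩ := exists_contDiffOn_Icc (n := 3) hg
  refine ⟨(2 : ℝ)⁻¹ • iteratedDerivWithin 2 g (Icc 0 ε) 0, ?_⟩
  refine ((isBigO_sub_taylorWithinEval (n := 2) hε (by exact_mod_cast h)).mono
    (nhdsWithin_mono _ Ioi_subset_Ici_self)).congr_left fun h ↦ ?_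
  simp [taylorWithinEval_succ, derivWithin_Icc_zero hε (hg.differentiableAt (by simp)), h0, h1,
    one_add_one_eq_two, smul_smul, mul_comm]

/-- Expansions at order h² become convergence at rate h of the rescaled curve h⁻² n(h). Any map
differentiable at the limit v preserves that rate. -/
theorem isBigO_sub_sq_smul_iff {n : ℝ → F} {v : F} :
    (fun h ↦ n h - h ^ 2 • v) =O[𝓝[>] 0] (fun h ↦ h ^ 3) ↔
      (fun h ↦ (h ^ 2)⁻¹ • n h - v) =O[𝓝[>] 0] fun h : ℝ ↦ h := by
  constructor <;> intro hn
  · have := (isBigO_refl (fun h : ℝ ↦ (h ^ 2)⁻¹) (𝓝[>] 0)).smul hn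
    refine this.congr' ?_ ?_ <;> filter_upwards [self_mem_nhdsWithin] with h hh <;>
      have hh' : h ≠ 0 := ne_of_gt hh
    · rw [smul_sub, smul_smul, inv_mul_cancel₀ (pow_ne_zero 2 hh'), one_smul]
    · simp only [smul_eq_mul]; field_simp
  · have := (isBigO_refl (fun h : ℝ ↦ h ^ 2) (𝓝[>] 0)).smul hn
    refine this.congr' ?_ ?_ <;> filter_upwards [self_mem_nhdsWithin] with h hh <;>
      have hh' : h ≠ 0 := ne_of_gt hh
    · rw [smul_sub, smul_smul, mul_inv_cancel₀ (pow_ne_zero 2 hh'), one_smul]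
    · simp only [smul_eq_mul]; ring

theorem tendsto_of_isBigO_sub {w : ℝ → F} {v : F}
    (hw : (fun h ↦ w h - v) =O[𝓝[>] 0] fun h : ℝ ↦ h) : Tendsto w (𝓝[>] 0) (𝓝 v) :=
  tendsto_sub_nhds_zero_iff.1 (hw.trans_tendsto (tendsto_nhdsWithin_of_tendsto_nhds tendsto_id))

theorem isBigO_comp_sub_of_differentiableAt {G : Type*} [NormedAddCommGroup G] [NormedSpace ℝ G]
    {Φ : F → G} {w : ℝ → F} {v : F} (hΦ : DifferentiableAt ℝ Φ v)
    (hw : (fun h ↦ w h - v) =O[𝓝[>] 0] fun h : ℝ ↦ h) :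
    (fun h ↦ Φ (w h) - Φ v) =O[𝓝[>] 0] fun h : ℝ ↦ h :=
  (hΦ.isBigO_sub.comp_tendsto (tendsto_of_isBigO_sub hw)).trans hw

theorem isBigO_sub_apply_zero {g : ℝ → F} (hg : DifferentiableAt ℝ g 0) :
    (fun h ↦ g h - g 0) =O[𝓝[>] 0] fun h : ℝ ↦ h := by
  simpa using hg.isBigO_sub.mono (nhdsWithin_le_nhds (s := Ioi 0))

/-- Since n already carries a factor h², an O(h) error in the operator suffices. So the inverse
Hessian, which is only C², does not spoil the O(h³) remainder. -/
theorem isBigO_clm_apply_sub_sq_smul {A : ℝ → E →L[ℝ] F} {A₀ : E →L[ℝ] F} {n : ℝ → E} {v : E}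
    (hA : (fun h ↦ A h - A₀) =O[𝓝[>] 0] fun h : ℝ ↦ h)
    (hn : (fun h ↦ n h - h ^ 2 • v) =O[𝓝[>] 0] fun h ↦ h ^ 3) :
    (fun h ↦ A h (n h) - h ^ 2 • A₀ v) =O[𝓝[>] 0] fun h ↦ h ^ 3 := by
  rw [isBigO_sub_sq_smul_iff] at hn ⊢
  have hΦ : DifferentiableAt ℝ (fun q : (E →L[ℝ] F) × E ↦ q.1 q.2) (A₀, v) :=
    differentiableAt_fst.clm_apply differentiableAt_snd
  refine (isBigO_comp_sub_of_differentiableAt (w := fun h ↦ (A h, (h ^ 2)⁻¹ • n h)) hΦ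
    (hA.prod_left hn)).congr_left fun h ↦ ?_
  simp

theorem sqrt_sq_smul (G : E →L[ℝ] E →L[ℝ] ℝ) {h : ℝ} (hh : 0 < h) (n : E) :
    √(G n n) = h ^ 2 * √(G ((h ^ 2)⁻¹ • n) ((h ^ 2)⁻¹ • n)) := by
  have h2 : 0 < h ^ 2 := by positivity
  simp only [map_smul, smul_apply, smul_eq_mul]
  rw [← mul_assoc, Real.sqrt_mul (by positivity), ← mul_assoc, Real.sqrt_mul_self (by positivity),
    mul_inv_cancel₀ h2.ne', one_mul]

theorem sqrt_apply_le (G : E →L[ℝ] E →L[ℝ] ℝ) (w : E) : √(G w w) ≤ √‖G‖ * ‖w‖ := by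
  refine Real.sqrt_le_iff.2 ⟨by positivity, ?_⟩
  rw [mul_pow, Real.sq_sqrt (norm_nonneg G)]
  refine (le_abs_self _).trans ((G.le_opNorm₂ w w).trans_eq (by ring))

theorem eventually_norm_le_add_one {G : ℝ → F} {G₀ : F} (hG : Tendsto G (𝓝[>] 0) (𝓝 G₀)) :
    ∀ᶠ h in 𝓝[>] 0, ‖G h‖ ≤ ‖G₀‖ + 1 :=
  hG.norm.eventually (eventually_le_nhds (lt_add_one ‖G₀‖))

theorem eventually_norm_sub_lt {G : ℝ → F} {G₀ : F} (hG : Tendsto G (𝓝[>] 0) (𝓝 G₀)) {c : ℝ}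
    (hc : 0 < c) : ∀ᶠ h in 𝓝[>] 0, ‖G h - G₀‖ < c := by
  have := (tendsto_sub_nhds_zero_iff.2 hG).norm
  rw [norm_zero] at this
  exact this.eventually (gt_mem_nhds hc)

theorem tendsto_clm_apply {A : ℝ → E →L[ℝ] F} {A₀ : E →L[ℝ] F} {w : ℝ → E} {v : E}
    (hA : Tendsto A (𝓝[>] 0) (𝓝 A₀)) (hw : Tendsto w (𝓝[>] 0) (𝓝 v)) :
    Tendsto (fun h ↦ A h (w h)) (𝓝[>] 0) (𝓝 (A₀ v)) :=
  ((continuous_fst.clm_apply continuous_snd).tendsto (A₀, v)).comp (hA.prodMk_nhds hw)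

theorem tendsto_clm_apply₂ {A : ℝ → E →L[ℝ] E →L[ℝ] F} {A₀ : E →L[ℝ] E →L[ℝ] F} {w : ℝ → E} {v : E}
    (hA : Tendsto A (𝓝[>] 0) (𝓝 A₀)) (hw : Tendsto w (𝓝[>] 0) (𝓝 v)) :
    Tendsto (fun h ↦ A h (w h) (w h)) (𝓝[>] 0) (𝓝 (A₀ v v)) :=
  tendsto_clm_apply (tendsto_clm_apply (F := E →L[ℝ] F) hA hw) hw

theorem isBigO_sqrt_norm {G : ℝ → E →L[ℝ] E →L[ℝ] ℝ} {G₀ : E →L[ℝ] E →L[ℝ] ℝ}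
    (hG : Tendsto G (𝓝[>] 0) (𝓝 G₀)) (w : ℝ → E) :
    (fun h ↦ √(G h (w h) (w h))) =O[𝓝[>] 0] w := by
  refine IsBigO.of_bound (√(‖G₀‖ + 1)) ?_
  filter_upwards [eventually_norm_le_add_one (F := E →L[ℝ] E →L[ℝ] ℝ) hG] with h hh
  rw [Real.norm_of_nonneg (Real.sqrt_nonneg _)]
  exact (sqrt_apply_le _ _).trans (by gcongr)

/-- By homogeneity the length is h² times that of the rescaled curve. If v ≠ 0, the square root is
differentiable at G₀(v, v) > 0. If v = 0 it is not, but the rescaled length is bounded by a multiple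
of the norm of the rescaled curve, which is O(h). -/
theorem exists_isBigO_sqrt_sub {G : ℝ → E →L[ℝ] E →L[ℝ] ℝ} {G₀ : E →L[ℝ] E →L[ℝ] ℝ}
    {n : ℝ → E} {v : E} (hG : (fun h ↦ G h - G₀) =O[𝓝[>] 0] fun h : ℝ ↦ h)
    (hpos : ∀ w, w ≠ 0 → 0 < G₀ w w)
    (hn : (fun h ↦ n h - h ^ 2 • v) =O[𝓝[>] 0] fun h ↦ h ^ 3) :
    ∃ d : ℝ, (fun h ↦ √(G h (n h) (n h)) - d * h ^ 2) =O[𝓝[>] 0] fun h ↦ h ^ 3 := by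
  refine ⟨√(G₀ v v), ?_⟩
  rw [isBigO_sub_sq_smul_iff] at hn
  have key : (fun h ↦ √(G h ((h ^ 2)⁻¹ • n h) ((h ^ 2)⁻¹ • n h)) - √(G₀ v v))
      =O[𝓝[>] 0] fun h : ℝ ↦ h := by
    by_cases hv : v = 0
    · subst hv
      simp only [sub_zero, map_zero, Real.sqrt_zero] at hn ⊢
      exact (isBigO_sqrt_norm (tendsto_of_isBigO_sub (F := E →L[ℝ] E →L[ℝ] ℝ) hG) _).trans hn
    · have hA : Differentiable ℝ (fun q : (E →L[ℝ] E →L[ℝ] ℝ) × E ↦ q.1 q.2) :=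
        fun q ↦ (isBoundedBilinearMap_apply (𝕜 := ℝ) (E := E) (F := E →L[ℝ] ℝ)).differentiableAt q
      have hB : Differentiable ℝ (fun q : (E →L[ℝ] E →L[ℝ] ℝ) × E ↦ q.1 q.2 q.2) :=
        Differentiable.clm_apply (𝕜 := ℝ) (E := (E →L[ℝ] E →L[ℝ] ℝ) × E) (G := E) (H := ℝ) hA
          differentiable_snd
      have hΦ : DifferentiableAt ℝ (fun q : (E →L[ℝ] E →L[ℝ] ℝ) × E ↦ √(q.1 q.2 q.2)) (G₀, v) :=
        DifferentiableAt.sqrt (f := fun q : (E →L[ℝ] E →L[ℝ] ℝ) × E ↦ q.1 q.2 q.2) (hB (G₀, v))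
          (hpos v hv).ne'
      exact isBigO_comp_sub_of_differentiableAt (w := fun h ↦ (G h, (h ^ 2)⁻¹ • n h)) hΦ
        (hG.prod_left hn)
  refine ((isBigO_refl (fun h : ℝ ↦ h ^ 2) (𝓝[>] 0)).mul key).congr' ?_ ?_
  · filter_upwards [self_mem_nhdsWithin] with h hh
    rw [sqrt_sq_smul (G h) hh (n h)]; ring
  · exact .of_eq (by ext h; ring)

theorem eventually_le_sqrt_apply {G : ℝ → E →L[ℝ] E →L[ℝ] ℝ} {G₀ : E →L[ℝ] E →L[ℝ] ℝ} {c : ℝ}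
    (hc : 0 < c) (hpos : ∀ w, c * ‖w‖ ^ 2 ≤ G₀ w w) (hG : Tendsto G (𝓝[>] 0) (𝓝 G₀)) :
    ∀ᶠ h in 𝓝[>] 0, ∀ w, √(c / 2) * ‖w‖ ≤ √(G h w w) := by
  -- A perturbation of the form of norm below c / 2 leaves the coercivity constant at least c / 2,
  -- uniformly in w.
  have h1 := eventually_norm_sub_lt (F := E →L[ℝ] E →L[ℝ] ℝ) hG (half_pos hc)
  filter_upwards [h1] with h hh w
  refine Real.le_sqrt_of_sq_le ?_
  rw [mul_pow, Real.sq_sqrt (by positivity)]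
  have h2 : |(G h - G₀) w w| ≤ c / 2 * ‖w‖ ^ 2 :=
    ((G h - G₀).le_opNorm₂ w w).trans (by
      rw [mul_assoc, ← sq]; gcongr)
  have h3 : G h w w = G₀ w w + (G h - G₀) w w := by simp
  have := (abs_le.1 h2).1
  linarith [hpos w]

/-- The quotient of the lengths of two consecutive vectors, where the second one is, to leading
order, quadratic in the first. If the leading coefficient `v` of the first vector vanishes, then
the quotient is `O(h³)`; so no nondegeneracy assumption is needed. -/
theorem exists_isLittleO_sqrt_div_sub {G G' : ℝ → E →L[ℝ] E →L[ℝ] ℝ}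
    {G₀ : E →L[ℝ] E →L[ℝ] ℝ} {B : ℝ → E →L[ℝ] E →L[ℝ] E} {B₀ : E →L[ℝ] E →L[ℝ] E}
    {n m : ℝ → E} {v : E} {c : ℝ} (hc : 0 < c) (hpos : ∀ w, c * ‖w‖ ^ 2 ≤ G₀ w w)
    (hG : Tendsto G (𝓝[>] 0) (𝓝 G₀)) (hG' : Tendsto G' (𝓝[>] 0) (𝓝 G₀))
    (hB : Tendsto B (𝓝[>] 0) (𝓝 B₀))
    (hn : (fun h ↦ n h - h ^ 2 • v) =O[𝓝[>] 0] fun h ↦ h ^ 3)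
    (hm : (fun h ↦ m h - B h (n h) (n h)) =o[𝓝[>] 0] fun h ↦ ‖n h‖ ^ 2) :
    ∃ k : ℝ, (fun h ↦ √(G' h (m h) (m h)) / √(G h (n h) (n h)) - k * h ^ 2)
      =o[𝓝[>] 0] fun h ↦ h ^ 2 := by
  by_cases hv : v = 0
  · refine ⟨0, ?_⟩
    simp only [hv, smul_zero, sub_zero, zero_mul] at hn ⊢
    have hBn : (fun h ↦ B h (n h) (n h)) =O[𝓝[>] 0] fun h ↦ ‖n h‖ ^ 2 := by
      refine IsBigO.of_bound (‖B₀‖ + 1) ?_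
      filter_upwards [eventually_norm_le_add_one (F := E →L[ℝ] E →L[ℝ] E) hB] with h hh
      refine ((B h).le_opNorm₂ _ _).trans ?_
      rw [norm_pow, norm_norm, mul_assoc, ← sq]
      gcongr
    have hm' : m =O[𝓝[>] 0] fun h ↦ ‖n h‖ ^ 2 := by
      simpa using hm.isBigO.add hBn
    obtain ⟨C, hC⟩ := ((isBigO_sqrt_norm hG' m).trans hm').bound
    have h1 : (fun h ↦ √(G' h (m h) (m h)) / √(G h (n h) (n h))) =O[𝓝[>] 0] n := by
      have hs : 0 < √(c / 2) := Real.sqrt_pos.2 (half_pos hc)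
      refine IsBigO.of_bound (|C| / √(c / 2)) ?_
      filter_upwards [hC, eventually_le_sqrt_apply hc hpos hG] with h h2 h3
      rw [norm_div, Real.norm_of_nonneg (Real.sqrt_nonneg (G h (n h) (n h)))]
      -- The denominator may vanish, in which case the quotient is 0; this inequality covers that
      -- case too.
      refine div_le_of_le_mul₀ (Real.sqrt_nonneg _) (by positivity) (h2.trans ?_)
      rw [norm_pow, norm_norm]
      calc C * ‖n h‖ ^ 2 ≤ |C| * ‖n h‖ ^ 2 := by gcongr; exact le_abs_self C
        _ = |C| / √(c / 2) * ‖n h‖ * (√(c / 2) * ‖n h‖) := by field_simp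
        _ ≤ _ := by gcongr; exact h3 _
    exact (h1.trans hn).trans_isLittleO
      ((isLittleO_pow_pow (by norm_num : 2 < 3)).mono nhdsWithin_le_nhds)
  · have hv0 : 0 < √(G₀ v v) :=
      Real.sqrt_pos.2 (lt_of_lt_of_le (by positivity) (hpos v))
    -- To leading order n is h² v and m is h⁴ B₀(v, v), so the quotient of lengths is h² times this
    -- constant.
    refine ⟨√(G₀ (B₀ v v) (B₀ v v)) / √(G₀ v v), ?_⟩
    have hw := tendsto_of_isBigO_sub (isBigO_sub_sq_smul_iff.1 hn)
    set w : ℝ → E := fun h ↦ (h ^ 2)⁻¹ • n h with hwdef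
    have hnO : n =O[𝓝[>] 0] fun h ↦ h ^ 2 := by
      have h1 : (fun h : ℝ ↦ h ^ 2 • v) =O[𝓝[>] 0] fun h ↦ h ^ 2 :=
        IsBigO.of_bound ‖v‖ (.of_forall fun h ↦ by rw [norm_smul, mul_comm])
      have h2 : (fun h ↦ n h - h ^ 2 • v) =O[𝓝[>] 0] fun h ↦ h ^ 2 :=
        hn.trans ((isLittleO_pow_pow (by norm_num : 2 < 3)).mono nhdsWithin_le_nhds).isBigO
      simpa using h2.add h1
    have hm4 : (fun h ↦ m h - B h (n h) (n h)) =o[𝓝[>] 0] fun h ↦ (h ^ 2) ^ 2 :=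
      hm.trans_isBigO ((hnO.norm_left).pow 2)
    have hz : Tendsto (fun h ↦ ((h ^ 2) ^ 2)⁻¹ • (m h - B h (n h) (n h))) (𝓝[>] 0) (𝓝 0) := by
      have := (isBigO_refl (fun h : ℝ ↦ ((h ^ 2) ^ 2)⁻¹) (𝓝[>] 0)).smul_isLittleO hm4
      refine (isLittleO_one_iff ℝ).1 (this.trans_isBigO ?_)
      refine IsBigO.of_bound 1 ?_
      filter_upwards [self_mem_nhdsWithin] with h hh
      have hh' : h ≠ 0 := ne_of_gt hh
      rw [smul_eq_mul, inv_mul_cancel₀ (by positivity)]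
      simp
    have hmw : Tendsto (fun h ↦ ((h ^ 2) ^ 2)⁻¹ • m h) (𝓝[>] 0) (𝓝 (B₀ v v)) := by
      have h1 := hz.add (tendsto_clm_apply₂ hB hw)
      rw [zero_add] at h1
      refine h1.congr fun h ↦ ?_
      simp only [hwdef, map_smul, smul_apply, smul_smul, smul_sub, sq, mul_inv]
      abel
    have hquot := (tendsto_clm_apply₂ hG' hmw).sqrt.div (tendsto_clm_apply₂ hG hw).sqrt hv0.ne'
    refine isLittleO_of_tendsto' ?_ ?_
    · filter_upwards [self_mem_nhdsWithin] with h hh h0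
      exact absurd h0 (pow_ne_zero 2 (ne_of_gt hh))
    · rw [← tendsto_sub_nhds_zero_iff] at hquot
      refine hquot.congr' ?_
      filter_upwards [self_mem_nhdsWithin] with h hh
      have hh' : (0 : ℝ) < h := hh
      -- The same homogeneity is used at h for n and at h² for m, giving factors h² and h⁴.
      rw [sqrt_sq_smul (G h) hh (n h), sqrt_sq_smul (G' h) (h := h ^ 2) (by positivity) (m h)]
      simp only [hwdef, Pi.div_apply]
      field_simp

/-- Second-order Taylor expansion in `v`, uniform in the parameter `a`. -/
theorem exists_isLittleO_taylor_two {A N : Type*} [NormedAddCommGroup A] [NormedSpace ℝ A]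
    [NormedAddCommGroup N] [NormedSpace ℝ N] {Ψ : A × N → F} {a₀ : A}
    (hΨ : ContDiffAt ℝ 2 Ψ (a₀, 0)) :
    ∃ B : N →L[ℝ] N →L[ℝ] F,
      (fun q : A × N ↦ Ψ q - Ψ (q.1, 0) - fderiv ℝ Ψ (q.1, 0) (0, q.2) - B q.2 q.2)
        =o[𝓝 (a₀, 0)] fun q ↦ ‖q.2‖ ^ 2 := by
  have h1 : ContDiffAt ℝ 1 (fderiv ℝ Ψ) (a₀, 0) := hΨ.fderiv_right (by norm_num)
  set D' := fderiv ℝ (fderiv ℝ Ψ) (a₀, 0)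
  -- Strict differentiability compares the derivative at two nearby points, here (a, s v) and (a,
  -- 0). This is what makes the expansion uniform in a.
  have hstrict : HasStrictFDerivAt (fderiv ℝ Ψ) D' (a₀, 0) := h1.hasStrictFDerivAt (by simp)
  let L : (A × N →L[ℝ] F) →L[ℝ] (N →L[ℝ] F) :=
    (ContinuousLinearMap.compL ℝ N (A × N) F).flip (.inr ℝ A N)
  -- Half the second derivative in the N-directions at the single point (a₀, 0); its variation with
  -- a is absorbed in the o(‖v‖²) term.
  refine ⟨(1 / 2 : ℝ) • (L.comp (D'.comp (.inr ℝ A N))), ?_⟩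
  refine isLittleO_iff.2 fun ε hε ↦ ?_
  have hdiff : ∀ᶠ q in 𝓝 (a₀, (0 : N)), DifferentiableAt ℝ Ψ q :=
    (hΨ.eventually (by simp)).mono fun q hq ↦ hq.differentiableAt (by simp)
  have hb := hstrict.isLittleO.def hε
  rw [nhds_prod_eq, Metric.nhds_basis_ball.prod_self.eventually_iff] at hb
  obtain ⟨r, hr, hb⟩ := hb
  obtain ⟨r', hr', hd⟩ := Metric.nhds_basis_ball.eventually_iff.1 hdiff
  filter_upwards [Metric.ball_mem_nhds (a₀, (0 : N)) (lt_min hr hr')] with q hq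
  obtain ⟨a, v⟩ := q
  have hball : ∀ s ∈ Icc (0 : ℝ) 1, (a, s • v) ∈ Metric.ball (a₀, (0 : N)) (min r r') := by
    intro s hs
    rw [Metric.mem_ball, Prod.dist_eq, max_lt_iff] at hq ⊢
    refine ⟨hq.1, lt_of_le_of_lt ?_ hq.2⟩
    simp only [dist_zero_right, norm_smul, Real.norm_of_nonneg hs.1]
    exact mul_le_of_le_one_left (norm_nonneg _) hs.2
  -- The Taylor remainder on the segment from (a, 0) to (a, v): the quantity to be bounded is k 1 -
  -- k 0, and the derivative of k is at most ε ‖v‖².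
  let k : ℝ → F := fun s ↦ Ψ (a, s • v) - s • fderiv ℝ Ψ (a, 0) (0, v)
    - s ^ 2 • ((1 / 2 : ℝ) • D' (0, v) (0, v))
  have hk : ∀ s ∈ Icc (0 : ℝ) 1, HasDerivWithinAt k
      (fderiv ℝ Ψ (a, s • v) (0, v) - fderiv ℝ Ψ (a, 0) (0, v) - s • D' (0, v) (0, v))
      (Icc 0 1) s := by
    intro s hs
    have hΨs := hd (Metric.ball_subset_ball (min_le_right _ _) (hball s hs))
    have e1 : HasDerivAt (fun s : ℝ ↦ (a, s • v)) (0, v) s := by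
      have := (hasDerivAt_const s a).prodMk ((hasDerivAt_id s).smul_const v)
      simpa using this
    have e2 : HasDerivAt (fun s : ℝ ↦ Ψ (a, s • v)) (fderiv ℝ Ψ (a, s • v) (0, v)) s :=
      hΨs.hasFDerivAt.comp_hasDerivAt s e1
    have e3 := ((e2.sub ((hasDerivAt_id s).smul_const (fderiv ℝ Ψ (a, 0) (0, v)))).sub
      (((hasDerivAt_id s).pow 2).smul_const ((1 / 2 : ℝ) • D' (0, v) (0, v)))).hasDerivWithinAt
        (s := Icc 0 1)
    convert! e3 using 1
    simp only [id, smul_smul, one_smul]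
    congr 2
    norm_num
    ring
  have hbd : ∀ s ∈ Ico (0 : ℝ) 1, ‖fderiv ℝ Ψ (a, s • v) (0, v) - fderiv ℝ Ψ (a, 0) (0, v)
      - s • D' (0, v) (0, v)‖ ≤ ε * ‖v‖ ^ 2 := by
    intro s hs
    have hs' : s ∈ Icc (0 : ℝ) 1 := Ico_subset_Icc_self hs
    have m1 := Metric.ball_subset_ball (min_le_left r r') (hball s hs')
    have m0 := Metric.ball_subset_ball (min_le_left r r') (hball 0 (by simp))
    rw [zero_smul] at m0
    have h2 : ‖fderiv ℝ Ψ (a, s • v) - fderiv ℝ Ψ (a, 0) - D' ((a, s • v) - (a, 0))‖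
        ≤ ε * ‖(a, s • v) - (a, (0 : N))‖ := hb (x := ((a, s • v), (a, 0))) ⟨m1, m0⟩
    have e : (a, s • v) - (a, (0 : N)) = s • ((0 : A), v) := by ext <;> simp
    have nv : ‖((0 : A), v)‖ = ‖v‖ := by simp [Prod.norm_def]
    rw [e, map_smul, norm_smul, nv, Real.norm_of_nonneg hs.1] at h2
    have h3 := ContinuousLinearMap.le_of_opNorm_le _ h2 ((0 : A), v)
    rw [nv] at h3
    refine le_trans (le_of_eq ?_) (h3.trans ?_)
    · simp
    · calc ε * (s * ‖v‖) * ‖v‖ = s * (ε * ‖v‖ ^ 2) := by ring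
        _ ≤ 1 * (ε * ‖v‖ ^ 2) := by gcongr; exact hs.2.le
        _ = _ := one_mul _
  have hmv := norm_image_sub_le_of_norm_deriv_le_segment_01' hk hbd
  rw [norm_pow, norm_norm]
  refine le_trans (le_of_eq ?_) hmv
  congr 1
  simp [k, L]
  abel

end Expansion

/-! ### The angle between a C² curve and its initial vector -/

section Angle

variable {F : Type*} [NormedAddCommGroup F] [InnerProductSpace ℝ F]

/-- In the right triangle with hypotenuse τ and one leg along e, the other leg is the component of τ
orthogonal to e. The tangent avoids the singularity of arccos at 1. -/
theorem arccos_inner_eq_arctan {e τ : F} (he : ‖e‖ = 1) (h : 0 < inner ℝ e τ) :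
    Real.arccos (inner ℝ e (‖τ‖⁻¹ • τ))
      = Real.arctan (‖τ - (inner ℝ e τ : ℝ) • e‖ / inner ℝ e τ) := by
  set a : ℝ := inner ℝ e τ with ha
  rw [Real.arctan_eq_arccos (by positivity)]
  congr 1
  have h1 : ‖τ - a • e‖ ^ 2 = ‖τ‖ ^ 2 - a ^ 2 := by
    rw [norm_sub_sq_real, real_inner_smul_right, real_inner_comm, ← ha, norm_smul, he]
    simp
    ring
  have h2 : 1 + (‖τ - a • e‖ / a) ^ 2 = (‖τ‖ / a) ^ 2 := by
    rw [div_pow, h1]; field_simp; ring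
  rw [h2, Real.sqrt_sq (by positivity), real_inner_smul_right, ← ha, inv_div, div_eq_inv_mul]

/-- The tangent of the angle is ‖g h‖ for a C² curve g with g 0 = 0, hence ‖g' 0‖ h + O(h²) for h >
0, and arctan x = x + O(x²). -/
theorem exists_isBigO_arccos_sub {τ : ℝ → F} (hτ : ContDiffAt ℝ 2 τ 0) (h0 : τ 0 ≠ 0) :
    ∃ c : ℝ, (fun h ↦ Real.arccos (inner ℝ (‖τ 0‖⁻¹ • τ 0) (‖τ h‖⁻¹ • τ h)) - c * h)
      =O[𝓝[>] 0] fun h ↦ h ^ 2 := by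
  have hn0 : 0 < ‖τ 0‖ := norm_pos_iff.2 h0
  set e : F := ‖τ 0‖⁻¹ • τ 0 with hedef
  have he : ‖e‖ = 1 := by rw [hedef, norm_smul, norm_inv, norm_norm, inv_mul_cancel₀ hn0.ne']
  have hi0 : (inner ℝ e (τ 0) : ℝ) = ‖τ 0‖ := by
    rw [hedef, real_inner_smul_left, real_inner_self_eq_norm_sq]; field_simp
  set a : ℝ → ℝ := fun h ↦ inner ℝ e (τ h) with hadef
  have ha : ContDiffAt ℝ 2 a 0 := contDiffAt_const.inner ℝ hτ
  have ha0 : 0 < a 0 := by rw [hadef]; simp only [hi0, hn0]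
  set p : ℝ → F := fun h ↦ τ h - a h • e with hpdef
  have hp : ContDiffAt ℝ 2 p 0 := hτ.sub (ha.smul contDiffAt_const)
  have hp0 : p 0 = 0 := by
    have : a 0 = ‖τ 0‖ := hi0
    simp only [hpdef, this]
    rw [hedef, smul_smul, mul_inv_cancel₀ hn0.ne', one_smul, sub_self]
  -- the tangent of the angle, as the length of a `C²` curve
  set g : ℝ → F := fun h ↦ (a h)⁻¹ • p h with hgdef
  have hg : ContDiffAt ℝ 2 g 0 := (ha.inv ha0.ne').smul hp
  have hg0 : g 0 = 0 := by simp [hgdef, hp0]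
  have hgt : (fun h ↦ ‖g h‖ - ‖deriv g 0‖ * h) =O[𝓝[>] 0] fun h ↦ h ^ 2 := by
    have h1 := (isBigO_sub_taylor_one hg).mono (nhdsWithin_mono _ Ioi_subset_Ici_self)
    refine IsBigO.trans (IsBigO.of_bound 1 ?_) h1
    filter_upwards [self_mem_nhdsWithin] with h hh
    have hh' : (0 : ℝ) < h := hh
    rw [hg0, sub_zero, one_mul, Real.norm_eq_abs]
    -- The reverse triangle inequality passes from curves to their norms; h > 0 turns ‖h • g' 0‖
    -- into h ‖g' 0‖.
    refine le_trans (le_of_eq ?_) (abs_norm_sub_norm_le (g h) (h • deriv g 0))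
    rw [norm_smul h, Real.norm_of_nonneg hh'.le, mul_comm h]
  have hgO : (fun h ↦ ‖g h‖) =O[𝓝[>] 0] fun h : ℝ ↦ h := by
    have h2 : (fun h : ℝ ↦ ‖deriv g 0‖ * h) =O[𝓝[>] 0] fun h : ℝ ↦ h :=
      isBigO_const_mul_self _ _ _
    have h3 : (fun h : ℝ ↦ h ^ 2) =O[𝓝[>] 0] fun h : ℝ ↦ h := by
      have := ((isLittleO_pow_pow (𝕜 := ℝ) (by norm_num : 1 < 2)).mono
        (nhdsWithin_le_nhds (s := Ioi 0))).isBigO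
      simpa using this
    simpa using (hgt.trans h3).add h2
  have harc : (fun x : ℝ ↦ Real.arctan x - x) =O[𝓝[≥] 0] fun x ↦ x ^ 2 := by
    have := isBigO_sub_taylor_one (g := Real.arctan) Real.contDiff_arctan.contDiffAt
    simpa [Real.deriv_arctan] using this
  have hgt0 : Tendsto (fun h ↦ ‖g h‖) (𝓝[>] 0) (𝓝[≥] 0) :=
    tendsto_nhdsWithin_iff.2 ⟨hgO.trans_tendsto (tendsto_nhdsWithin_of_tendsto_nhds tendsto_id),
      .of_forall fun h ↦ norm_nonneg _⟩
  refine ⟨‖deriv g 0‖, ?_⟩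
  have hsum := ((harc.comp_tendsto hgt0).trans (hgO.pow 2)).add hgt
  refine hsum.congr' ?_ .rfl
  have hapos : ∀ᶠ h in 𝓝[>] 0, 0 < a h :=
    (ha.continuousAt.eventually (lt_mem_nhds ha0)).filter_mono nhdsWithin_le_nhds
  filter_upwards [hapos] with h hh
  rw [arccos_inner_eq_arctan he hh]
  have : ‖g h‖ = ‖τ h - (inner ℝ e (τ h) : ℝ) • e‖ / inner ℝ e (τ h) := by
    simp only [hgdef, norm_smul, norm_inv, Real.norm_of_nonneg hh.le, div_eq_inv_mul]
    rfl
  simp only [Function.comp_apply, this]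
  ring

end Angle

/-! ### Second-order vanishing along the prediction path -/

section Indicators

variable {E : Type*} [NormedAddCommGroup E] [NormedSpace ℝ E] [FiniteDimensional ℝ E]
  {M : Type*} [TopologicalSpace M] [ChartedSpace E M] [IsManifold 𝓘(ℝ, E) ∞ M]
  [RiemannianBundle (fun x : M ↦ TangentSpace 𝓘(ℝ, E) x)]
  [IsContMDiffRiemannianBundle 𝓘(ℝ, E) ∞ E (fun x : M ↦ TangentSpace 𝓘(ℝ, E) x)]

/-- The point `x₀` is a nondegenerate critical point of `f(·, l)`, where `f` is of class `C⁴` on the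
open set `V`. -/
structure IsRegularSolution (V : Set (M × ℝ)) (f : M × ℝ → ℝ) (x₀ : M) (l : ℝ) : Prop where
  isOpen : IsOpen V
  contMDiffOn : ContMDiffOn (𝓘(ℝ, E).prod 𝓘(ℝ, ℝ)) 𝓘(ℝ, ℝ) 4 f V
  mem : (x₀, l) ∈ V
  grad_eq_zero : grad E (fun p ↦ f (p, l)) x₀ = 0
  hess_isInvertible : (hess E (fun p ↦ f (p, l)) x₀).IsInvertible

theorem chartInv_chart_self (x₀ : M) : chartInv x₀ (chartAt E x₀ x₀) = x₀ :=
  (chartAt E x₀).left_inv (mem_chart_source E x₀)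

/-- The prediction path in the chart at its starting point, together with the parameter. -/
def chartPath (f : M × ℝ → ℝ) (R : TangentBundle 𝓘(ℝ, E) M → M) (x₀ : M) (l h : ℝ) : E × ℝ :=
  (chartRetraction R x₀ (chartAt E x₀ x₀, h • chartPrediction f x₀ (chartAt E x₀ x₀, l)), l + h)

/-- The Newton update vector along the prediction path, in the chart. -/
def chartUpdate (f : M × ℝ → ℝ) (R : TangentBundle 𝓘(ℝ, E) M → M) (x₀ : M) (l h : ℝ) : E :=
  chartNewton f x₀ (chartPath f R x₀ l h)

/-- The first Newton iterate in the chart, together with the parameter. -/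
def chartIterate (f : M × ℝ → ℝ) (R : TangentBundle 𝓘(ℝ, E) M → M) (x₀ : M) (l h : ℝ) : E × ℝ :=
  (chartRetraction R x₀ ((chartPath f R x₀ l h).1, chartUpdate f R x₀ l h), l + h)

namespace IsRegularSolution

variable {V : Set (M × ℝ)} {f : M × ℝ → ℝ} {x₀ : M} {l : ℝ}
  {R : TangentBundle 𝓘(ℝ, E) M → M}

theorem mem_chartDomain (hs : IsRegularSolution (E := E) V f x₀ l) :
    (chartAt E x₀ x₀, l) ∈ chartDomain V x₀ :=
  ⟨mem_chart_target E x₀, by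
    change (chartInv x₀ (chartAt E x₀ x₀), l) ∈ V
    rw [chartInv_chart_self]; exact hs.mem⟩

theorem chartGrad_eq_zero (hs : IsRegularSolution (E := E) V f x₀ l) :
    chartGrad f x₀ (chartAt E x₀ x₀, l) = 0 := by
  -- The base point occurs in the type of the gradient, so the equality of points is generalized and
  -- substituted instead of rewritten.
  have h : ∀ p, p = x₀ → grad E (fun p ↦ f (p, l)) p = 0 := by
    rintro _ rfl
    exact hs.grad_eq_zero
  rw [← chartCoord_grad hs.isOpen hs.contMDiffOn hs.mem_chartDomain, h _ (chartInv_chart_self x₀),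
    map_zero]

theorem isInvertible_chartHess (hs : IsRegularSolution (E := E) V f x₀ l) :
    (chartHess f x₀ (chartAt E x₀ x₀, l)).IsInvertible := by
  have h : ∀ p, p = x₀ → (hess E (fun p ↦ f (p, l)) p).IsInvertible := by
    rintro _ rfl
    exact hs.hess_isInvertible
  exact RiemannianContinuation.isInvertible_chartHess hs.isOpen hs.contMDiffOn hs.mem_chartDomain
    (h _ (chartInv_chart_self x₀))

theorem contDiffAt_chartGrad (hs : IsRegularSolution (E := E) V f x₀ l) :
    ContDiffAt ℝ 3 (chartGrad f x₀) (chartAt E x₀ x₀, l) :=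
  (contDiffOn_chartGrad hs.isOpen hs.contMDiffOn x₀).contDiffAt
    ((isOpen_chartDomain hs.isOpen x₀).mem_nhds hs.mem_chartDomain)

theorem contDiffAt_chartHess (hs : IsRegularSolution (E := E) V f x₀ l) :
    ContDiffAt ℝ 2 (chartHess f x₀) (chartAt E x₀ x₀, l) :=
  (contDiffOn_chartHess hs.isOpen hs.contMDiffOn x₀).contDiffAt
    ((isOpen_chartDomain hs.isOpen x₀).mem_nhds hs.mem_chartDomain)

theorem contDiffAt_inverse (hs : IsRegularSolution (E := E) V f x₀ l) :
    ContDiffAt ℝ 2 (fun q ↦ (chartHess f x₀ q).inverse) (chartAt E x₀ x₀, l) :=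
  contDiffAt_inverse_chartHess hs.isOpen hs.contMDiffOn hs.mem_chartDomain
    hs.isInvertible_chartHess

theorem chartPath_zero (hR : IsRetraction R) :
    chartPath f R x₀ l 0 = (chartAt E x₀ x₀, l) := by
  simp [chartPath, hR.chartRetraction_zero (mem_chart_target E x₀)]

theorem contDiffAt_chartPath (hR : IsRetraction R) :
    ContDiffAt ℝ ∞ (chartPath (E := E) f R x₀ l) 0 := by
  refine ContDiffAt.prodMk ?_ (contDiffAt_const.add contDiffAt_id)
  refine ContDiffAt.comp (0 : ℝ) (g := chartRetraction R x₀) ?_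
    (contDiffAt_const.prodMk (contDiffAt_id.smul contDiffAt_const))
  simpa using hR.contDiffAt_chartRetraction (mem_chart_target E x₀)

theorem hasDerivAt_chartPath (hR : IsRetraction R) :
    HasDerivAt (chartPath f R x₀ l) (chartPrediction f x₀ (chartAt E x₀ x₀, l), 1) 0 := by
  refine HasDerivAt.prodMk ?_ ((hasDerivAt_id (0 : ℝ)).const_add l)
  have h1 : HasDerivAt (fun h : ℝ ↦ h • chartPrediction f x₀ (chartAt E x₀ x₀, l))
      (chartPrediction f x₀ (chartAt E x₀ x₀, l)) 0 := by
    simpa using (hasDerivAt_id (0 : ℝ)).smul_const (chartPrediction f x₀ (chartAt E x₀ x₀, l))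
  exact (hR.hasFDerivAt_chartRetraction (mem_chart_target E x₀)).comp_hasDerivAt_of_eq 0 h1
    (by simp)

theorem tendsto_chartPath (hR : IsRetraction R) :
    Tendsto (chartPath f R x₀ l) (𝓝 0) (𝓝 (chartAt E x₀ x₀, l)) := by
  have := (contDiffAt_chartPath (f := f) (x₀ := x₀) (l := l) hR).continuousAt.tendsto
  rwa [chartPath_zero hR] at this

/-- The Christoffel term is linear in the gradient, which vanishes at the solution. -/
theorem chartHess_apply (hs : IsRegularSolution (E := E) V f x₀ l) (v : E) :
    chartHess f x₀ (chartAt E x₀ x₀, l) v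
      = fderiv ℝ (chartGrad f x₀) (chartAt E x₀ x₀, l) (v, 0) := by
  simp [chartHess, hs.chartGrad_eq_zero]

theorem chartHess_chartPrediction (hs : IsRegularSolution (E := E) V f x₀ l) :
    chartHess f x₀ (chartAt E x₀ x₀, l) (chartPrediction f x₀ (chartAt E x₀ x₀, l))
      = -fderiv ℝ (chartGrad f x₀) (chartAt E x₀ x₀, l) (0, 1) := by
  rw [chartPrediction, map_neg]
  congr 1
  exact (hs.isInvertible_chartHess.inverse_apply_eq.1 rfl).symm

/-- The gradient vanishes to second order along the prediction path. -/
theorem exists_isBigO_chartGrad (hs : IsRegularSolution (E := E) V f x₀ l) (hR : IsRetraction R) :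
    ∃ a : E, (fun h ↦ chartGrad f x₀ (chartPath f R x₀ l h) - h ^ 2 • a)
      =O[𝓝[>] 0] fun h ↦ h ^ 3 := by
  have hγ := hs.contDiffAt_chartGrad
  rw [← chartPath_zero (f := f) (R := R) hR] at hγ
  refine exists_isBigO_sub_sq_smul (g := fun h ↦ chartGrad f x₀ (chartPath f R x₀ l h))
    (ContDiffAt.comp (0 : ℝ) hγ ((contDiffAt_chartPath hR).of_le ENat.LEInfty.out)) ?_ ?_
  · rw [chartPath_zero hR, hs.chartGrad_eq_zero]
  · have h1 := (hγ.differentiableAt (by simp)).hasFDerivAt.comp_hasDerivAt (0 : ℝ)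
      (hasDerivAt_chartPath (f := f) (x₀ := x₀) (l := l) hR)
    refine h1.deriv.trans ?_
    rw [chartPath_zero hR]
    -- Splitting the velocity into its point and parameter parts gives Hess t + ∂grad/∂λ, which
    -- vanishes by the choice of t.
    have h2 : (chartPrediction f x₀ (chartAt E x₀ x₀, l), (1 : ℝ))
        = (chartPrediction f x₀ (chartAt E x₀ x₀, l), 0) + (0, 1) := by simp
    rw [h2, map_add, ← hs.chartHess_apply, hs.chartHess_chartPrediction, neg_add_cancel]

/-- The expansion of the gradient supplies the factor h², and the inverse Hessian along the path
differs from its initial value by O(h). -/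
theorem exists_isBigO_chartUpdate (hs : IsRegularSolution (E := E) V f x₀ l)
    (hR : IsRetraction R) :
    ∃ v : E, (fun h ↦ chartUpdate f R x₀ l h - h ^ 2 • v) =O[𝓝[>] 0] fun h ↦ h ^ 3 := by
  obtain ⟨a, ha⟩ := hs.exists_isBigO_chartGrad hR
  have hI := hs.contDiffAt_inverse
  rw [← chartPath_zero (f := f) (R := R) hR] at hI
  have hd : DifferentiableAt ℝ (fun h ↦ -(chartHess f x₀ (chartPath f R x₀ l h)).inverse) 0 :=
    (DifferentiableAt.comp (0 : ℝ) (hI.differentiableAt (by simp))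
      ((contDiffAt_chartPath hR).differentiableAt (by simp))).neg
  exact ⟨_, isBigO_clm_apply_sub_sq_smul (isBigO_sub_apply_zero hd) ha⟩

theorem tendsto_chartUpdate (hs : IsRegularSolution (E := E) V f x₀ l) (hR : IsRetraction R) :
    Tendsto (chartUpdate f R x₀ l) (𝓝 0) (𝓝 0) := by
  have h1 : ContinuousAt (chartNewton f x₀) (chartAt E x₀ x₀, l) :=
    (hs.contDiffAt_inverse.continuousAt.clm_apply hs.contDiffAt_chartGrad.continuousAt).neg
  have h2 : chartNewton f x₀ (chartAt E x₀ x₀, l) = 0 := by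
    simp [chartNewton, hs.chartGrad_eq_zero]
  have h3 := h1.tendsto.comp (tendsto_chartPath (f := f) (l := l) hR)
  rwa [h2] at h3

theorem eventually_chartPath_mem (hs : IsRegularSolution (E := E) V f x₀ l)
    (hR : IsRetraction R) :
    ∀ᶠ h in 𝓝 0, chartPath f R x₀ l h ∈ chartDomain V x₀ :=
  (tendsto_chartPath hR).eventually
    ((isOpen_chartDomain hs.isOpen x₀).mem_nhds hs.mem_chartDomain)

theorem predictionVector_eq (hs : IsRegularSolution (E := E) V f x₀ l) :
    chartVector x₀ (chartAt E x₀ x₀, chartPrediction f x₀ (chartAt E x₀ x₀, l))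
      = ⟨x₀, predictionVector E f x₀ l⟩ := by
  have h := chartCoord_predictionVector hs.isOpen hs.contMDiffOn hs.mem_chartDomain
  have h1 : chartVector x₀ (chartAt E x₀ x₀, chartPrediction f x₀ (chartAt E x₀ x₀, l))
      = ⟨chartInv x₀ (chartAt E x₀ x₀),
        predictionVector E f (chartInv x₀ (chartAt E x₀ x₀)) l⟩ := by
    rw [← h, chartVector]
    congr 1
    exact chartFrame_chartCoord (chartInv_mem (mem_chart_target E x₀)) _
  rw [h1, chartInv_chart_self]

end IsRegularSolution
end Indicators

/-! ### Asymptotics of δ, κ and α at a regular solution -/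

section Asymptotics

variable {E : Type*} [NormedAddCommGroup E] [NormedSpace ℝ E] [FiniteDimensional ℝ E]
  {M : Type*} [TopologicalSpace M] [ChartedSpace E M] [IsManifold 𝓘(ℝ, E) ∞ M]
  [RiemannianBundle (fun x : M ↦ TangentSpace 𝓘(ℝ, E) x)]
  [IsContMDiffRiemannianBundle 𝓘(ℝ, E) ∞ E (fun x : M ↦ TangentSpace 𝓘(ℝ, E) x)]

theorem chartVector_chart_self (x₀ : M) (v : E) :
    chartVector x₀ (chartAt E x₀ x₀, v) = ⟨x₀, chartFrame x₀ x₀ v⟩ := by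
  simp only [chartVector]
  rw [chartInv_chart_self]

namespace IsRegularSolution

variable {V : Set (M × ℝ)} {f : M × ℝ → ℝ} {x₀ : M} {l : ℝ}
  {R : TangentBundle 𝓘(ℝ, E) M → M}

theorem predictionVector_eq_chartFrame (hs : IsRegularSolution (E := E) V f x₀ l) :
    predictionVector E f x₀ l
      = chartFrame x₀ x₀ (chartPrediction f x₀ (chartAt E x₀ x₀, l)) := by
  have h := hs.predictionVector_eq
  rw [chartVector_chart_self] at h
  exact (TotalSpace.mk_inj.1 h).symm

/-- For small h the retracted point stays in the domain of the chart at x₀, so coordinates determine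
it. -/
theorem eventually_predictionPath (hs : IsRegularSolution (E := E) V f x₀ l)
    (hR : IsRetraction R) :
    ∀ᶠ h in 𝓝 0, predictionPath f R x₀ l h = chartInv x₀ (chartPath f R x₀ l h).1 := by
  have hc : Continuous fun h : ℝ ↦
      (chartAt E x₀ x₀, h • chartPrediction f x₀ (chartAt E x₀ x₀, l)) := by fun_prop
  have h1 := hc.tendsto 0
  rw [zero_smul] at h1
  filter_upwards [h1.eventually (hR.eventually_mem_source (mem_chart_target E x₀))] with h hh
  have h2 : predictionPath f R x₀ l h
      = R (chartVector x₀ (chartAt E x₀ x₀, h • chartPrediction f x₀ (chartAt E x₀ x₀, l))) := by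
    rw [predictionPath, hs.predictionVector_eq_chartFrame, chartVector_chart_self, map_smul]
  rw [h2]
  exact ((chartAt E x₀).left_inv hh).symm

/-- The base point and the parameter are variables tied by equations, so that substitution can
change the tangent space in which the vector lives. -/
theorem norm_newtonVector (hs : IsRegularSolution (E := E) V f x₀ l) {p : M} {μ : ℝ} {q : E × ℝ}
    (hp : p = chartInv x₀ q.1) (hμ : μ = q.2) (hq : q ∈ chartDomain V x₀) :
    ‖newtonVector E f p μ‖
      = √(chartMetric x₀ q.1 (chartNewton f x₀ q) (chartNewton f x₀ q)) := by
  subst hp hμ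
  rw [norm_eq_sqrt_chartMetric hq.1, chartCoord_newtonVector hs.isOpen hs.contMDiffOn hq]

theorem map_newtonVector (hs : IsRegularSolution (E := E) V f x₀ l) {p : M} {μ : ℝ} {q : E × ℝ}
    (hp : p = chartInv x₀ q.1) (hμ : μ = q.2) (hq : q ∈ chartDomain V x₀) :
    (⟨p, newtonVector E f p μ⟩ : TangentBundle 𝓘(ℝ, E) M)
      = chartVector x₀ (q.1, chartNewton f x₀ q) := by
  subst hp hμ
  rw [chartVector, ← chartCoord_newtonVector hs.isOpen hs.contMDiffOn hq]
  congr 1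
  exact (chartFrame_chartCoord (chartInv_mem hq.1) _).symm

theorem tendsto_chartIterate (hs : IsRegularSolution (E := E) V f x₀ l) (hR : IsRetraction R) :
    Tendsto (chartIterate f R x₀ l) (𝓝 0) (𝓝 (chartAt E x₀ x₀, l)) := by
  have h1 : Tendsto (fun h ↦ ((chartPath f R x₀ l h).1, chartUpdate f R x₀ l h)) (𝓝 0)
      (𝓝 (chartAt E x₀ x₀, 0)) :=
    ((tendsto_chartPath hR).fst_nhds).prodMk_nhds (hs.tendsto_chartUpdate hR)
  have h2 := (hR.contDiffAt_chartRetraction (mem_chart_target E x₀)).continuousAt.tendsto.comp h1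
  rw [hR.chartRetraction_zero (mem_chart_target E x₀)] at h2
  have h3 : Tendsto (fun h : ℝ ↦ l + h) (𝓝 0) (𝓝 l) := by
    have : Continuous fun h : ℝ ↦ l + h := by fun_prop
    simpa using this.tendsto 0
  exact h2.prodMk_nhds h3

theorem eventually_chartIterate_mem (hs : IsRegularSolution (E := E) V f x₀ l)
    (hR : IsRetraction R) :
    ∀ᶠ h in 𝓝 0, chartIterate f R x₀ l h ∈ chartDomain V x₀ :=
  (hs.tendsto_chartIterate hR).eventually
    ((isOpen_chartDomain hs.isOpen x₀).mem_nhds hs.mem_chartDomain)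

theorem eventually_firstIterate (hs : IsRegularSolution (E := E) V f x₀ l)
    (hR : IsRetraction R) :
    ∀ᶠ h in 𝓝 0, firstIterate f R x₀ l h = chartInv x₀ (chartIterate f R x₀ l h).1 := by
  have h1 : Tendsto (fun h ↦ ((chartPath f R x₀ l h).1, chartUpdate f R x₀ l h)) (𝓝 0)
      (𝓝 (chartAt E x₀ x₀, 0)) :=
    ((tendsto_chartPath hR).fst_nhds).prodMk_nhds (hs.tendsto_chartUpdate hR)
  filter_upwards [h1.eventually (hR.eventually_mem_source (mem_chart_target E x₀)),
    hs.eventually_predictionPath hR, hs.eventually_chartPath_mem hR] with h h2 h3 h4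
  have h5 : firstIterate f R x₀ l h
      = R (chartVector x₀ ((chartPath f R x₀ l h).1, chartUpdate f R x₀ l h)) := by
    unfold firstIterate firstUpdate chartUpdate
    rw [hs.map_newtonVector (μ := l + h) (q := chartPath f R x₀ l h) h3 rfl h4]
  rw [h5]
  exact ((chartAt E x₀).left_inv h2).symm

theorem eventually_norm_firstUpdate (hs : IsRegularSolution (E := E) V f x₀ l)
    (hR : IsRetraction R) :
    ∀ᶠ h in 𝓝 0, ‖firstUpdate f R x₀ l h‖ = √(chartMetric x₀ (chartPath f R x₀ l h).1
      (chartUpdate f R x₀ l h) (chartUpdate f R x₀ l h)) := by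
  filter_upwards [hs.eventually_predictionPath hR, hs.eventually_chartPath_mem hR] with h h1 h2
  unfold firstUpdate chartUpdate
  exact hs.norm_newtonVector (q := chartPath f R x₀ l h) h1 rfl h2

theorem eventually_norm_newtonVector_firstIterate (hs : IsRegularSolution (E := E) V f x₀ l)
    (hR : IsRetraction R) :
    ∀ᶠ h in 𝓝 0, ‖newtonVector E f (firstIterate f R x₀ l h) (l + h)‖
      = √(chartMetric x₀ (chartIterate f R x₀ l h).1
        (chartNewton f x₀ (chartIterate f R x₀ l h))
        (chartNewton f x₀ (chartIterate f R x₀ l h))) := by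
  filter_upwards [hs.eventually_firstIterate hR, hs.eventually_chartIterate_mem hR] with h h1 h2
  exact hs.norm_newtonVector (q := chartIterate f R x₀ l h) h1 rfl h2

theorem contDiffAt_chartMetric (x₀ : M) :
    ContDiffAt ℝ ∞ (chartMetric (E := E) x₀) (chartAt E x₀ x₀) :=
  (contDiffOn_chartMetric x₀).contDiffAt ((isOpen_chartTarget x₀).mem_nhds (mem_chart_target E x₀))

/-- The metric is positive definite in the chart. -/
theorem exists_le_chartMetric (x₀ : M) :
    ∃ c > 0, ∀ w : E, c * ‖w‖ ^ 2 ≤ chartMetric x₀ (chartAt E x₀ x₀) w w := by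
  set p := chartInv x₀ (chartAt E x₀ x₀)
  have hp : p ∈ (chartAt E x₀).source := chartInv_mem (mem_chart_target E x₀)
  obtain ⟨C, hC, hb⟩ := ContinuousLinearMap.bound
    (𝕜 := ℝ) (E := TangentSpace 𝓘(ℝ, E) p) (F := E) (chartCoord x₀ p)
  refine ⟨(C ^ 2)⁻¹, by positivity, fun w ↦ ?_⟩
  have h1 := hb (chartFrame x₀ p w)
  rw [chartCoord_chartFrame hp] at h1
  rw [chartMetric_apply, real_inner_self_eq_norm_sq, inv_mul_le_iff₀ (by positivity), ← mul_pow]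
  gcongr

theorem exists_isBigO_delta (hs : IsRegularSolution (E := E) V f x₀ l) (hR : IsRetraction R) :
    ∃ d : ℝ, (fun h ↦ delta f R x₀ l h - d * h ^ 2) =O[𝓝[>] 0] fun h ↦ h ^ 3 := by
  obtain ⟨v, hv⟩ := hs.exists_isBigO_chartUpdate hR
  obtain ⟨c, hc, hpos⟩ := exists_le_chartMetric (E := E) x₀
  have hg : DifferentiableAt ℝ (fun h ↦ chartMetric x₀ (chartPath f R x₀ l h).1) 0 := by
    refine DifferentiableAt.comp (0 : ℝ) (g := chartMetric x₀) ?_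
      ((contDiffAt_chartPath hR).differentiableAt (by simp)).fst
    rw [chartPath_zero hR]
    exact (contDiffAt_chartMetric x₀).differentiableAt (by simp)
  have hO := isBigO_sub_apply_zero (F := E →L[ℝ] E →L[ℝ] ℝ) hg
  simp only [chartPath_zero hR] at hO
  obtain ⟨d, hd⟩ := exists_isBigO_sqrt_sub hO
    (fun w hw ↦ lt_of_lt_of_le (by positivity) (hpos w)) hv
  refine ⟨d, hd.congr' ?_ .rfl⟩
  filter_upwards [nhdsWithin_le_nhds (hs.eventually_norm_firstUpdate hR)] with h hh
  rw [delta, hh]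

/-- The gradient after a retraction step `v` from the point with coordinates `a`. -/
def chartStep (f : M × ℝ → ℝ) (R : TangentBundle 𝓘(ℝ, E) M → M) (x₀ : M)
    (q : (E × ℝ) × E) : E :=
  chartGrad f x₀ (chartRetraction R x₀ (q.1.1, q.2), q.1.2)

theorem contDiffAt_chartStep (hV : IsOpen V)
    (hf : ContMDiffOn (𝓘(ℝ, E).prod 𝓘(ℝ, ℝ)) 𝓘(ℝ, ℝ) 4 f V) (hR : IsRetraction R) {a : E × ℝ}
    (ha : a ∈ chartDomain V x₀) : ContDiffAt ℝ 3 (chartStep f R x₀) (a, 0) := by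
  refine ContDiffAt.comp (a, (0 : E)) (g := chartGrad f x₀)
    (f := fun q : (E × ℝ) × E ↦ (chartRetraction R x₀ (q.1.1, q.2), q.1.2)) ?_
    (ContDiffAt.prodMk ?_ (contDiff_snd.comp contDiff_fst).contDiffAt)
  · simp only [hR.chartRetraction_zero ha.1]
    exact (contDiffOn_chartGrad hV hf x₀).contDiffAt ((isOpen_chartDomain hV x₀).mem_nhds ha)
  · exact ContDiffAt.comp (a, (0 : E)) (g := chartRetraction R x₀)
      ((hR.contDiffAt_chartRetraction ha.1).of_le ENat.LEInfty.out)
      ((contDiff_fst.comp contDiff_fst).prodMk contDiff_snd).contDiffAt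

theorem chartStep_zero (hR : IsRetraction R) {a : E × ℝ} (ha : a ∈ chartDomain V x₀) :
    chartStep f R x₀ (a, 0) = chartGrad f x₀ a := by
  simp [chartStep, hR.chartRetraction_zero ha.1]

/-- The retraction has derivative id at the zero vector, so to first order the step moves the point
by v. -/
theorem fderiv_chartStep (hV : IsOpen V)
    (hf : ContMDiffOn (𝓘(ℝ, E).prod 𝓘(ℝ, ℝ)) 𝓘(ℝ, ℝ) 4 f V) (hR : IsRetraction R) {a : E × ℝ}
    (ha : a ∈ chartDomain V x₀) (v : E) :
    fderiv ℝ (chartStep f R x₀) (a, 0) (0, v) = fderiv ℝ (chartGrad f x₀) a (v, 0) := by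
  have h1 : HasFDerivAt (fun w : E ↦ chartStep f R x₀ (a, w))
      ((fderiv ℝ (chartStep f R x₀) (a, 0)).comp (.inr ℝ (E × ℝ) E)) 0 :=
    ((contDiffAt_chartStep hV hf hR ha).differentiableAt (by simp)).hasFDerivAt.comp (0 : E)
      (hasFDerivAt_prodMk_right a (0 : E))
  have h2 : HasFDerivAt (chartGrad f x₀) (fderiv ℝ (chartGrad f x₀) a)
      (chartRetraction R x₀ (a.1, 0), a.2) := by
    rw [hR.chartRetraction_zero ha.1]
    exact (((contDiffOn_chartGrad hV hf x₀).contDiffAt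
      ((isOpen_chartDomain hV x₀).mem_nhds ha)).differentiableAt (by simp)).hasFDerivAt
  have h3 : HasFDerivAt (fun w : E ↦ chartStep f R x₀ (a, w)) _ 0 :=
    HasFDerivAt.comp (0 : E) (f := fun w : E ↦ (chartRetraction R x₀ (a.1, w), a.2)) h2
      ((hR.hasFDerivAt_chartRetraction ha.1).prodMk (hasFDerivAt_const a.2 (0 : E)))
  exact DFunLike.congr_fun (h1.unique h3) v

theorem eventually_isInvertible_chartHess (hs : IsRegularSolution (E := E) V f x₀ l) :
    ∀ᶠ q in 𝓝 (chartAt E x₀ x₀, l), (chartHess f x₀ q).IsInvertible := by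
  have : CompleteSpace E := FiniteDimensional.complete ℝ E
  obtain ⟨e, he⟩ := hs.isInvertible_chartHess
  have h1 := hs.contDiffAt_chartHess.continuousAt
  have h2 := e.nhds
  rw [he] at h2
  exact h1.eventually h2

/-- The coefficient of the second Newton update as a quadratic expression in the first one. -/
def chartQuadratic (f : M × ℝ → ℝ) (x₀ : M) (B : E →L[ℝ] E →L[ℝ] E) (a b : E × ℝ) :
    E →L[ℝ] E →L[ℝ] E :=
  (ContinuousLinearMap.compL ℝ E E E (-(chartHess f x₀ b).inverse)).comp
    ((christoffel x₀ a.1).comp (chartHess f x₀ a) + B)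

/-- The quadratic coefficient depends on the predicted point and on the iterate. Both tend to the
solution, so continuity there is what gives a limiting coefficient. -/
theorem continuousAt_chartQuadratic (hs : IsRegularSolution (E := E) V f x₀ l)
    (B : E →L[ℝ] E →L[ℝ] E) :
    ContinuousAt (fun q : (E × ℝ) × (E × ℝ) ↦ chartQuadratic f x₀ B q.1 q.2)
      ((chartAt E x₀ x₀, l), (chartAt E x₀ x₀, l)) := by
  have d1 : ContinuousAt (fun q : (E × ℝ) × (E × ℝ) ↦ christoffel x₀ q.1.1)
      ((chartAt E x₀ x₀, l), (chartAt E x₀ x₀, l)) :=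
    ContinuousAt.comp (g := christoffel x₀) (f := fun q : (E × ℝ) × (E × ℝ) ↦ q.1.1)
      (x := ((chartAt E x₀ x₀, l), (chartAt E x₀ x₀, l)))
      ((contDiffOn_christoffel x₀).contDiffAt
        ((isOpen_chartTarget x₀).mem_nhds (mem_chart_target E x₀))).continuousAt
      (continuous_fst.comp continuous_fst).continuousAt
  have d2 : ContinuousAt (fun q : (E × ℝ) × (E × ℝ) ↦ chartHess f x₀ q.1)
      ((chartAt E x₀ x₀, l), (chartAt E x₀ x₀, l)) :=
    ContinuousAt.comp (g := chartHess f x₀) (f := fun q : (E × ℝ) × (E × ℝ) ↦ q.1)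
      (x := ((chartAt E x₀ x₀, l), (chartAt E x₀ x₀, l)))
      hs.contDiffAt_chartHess.continuousAt continuousAt_fst
  have d3 : ContinuousAt (fun q : (E × ℝ) × (E × ℝ) ↦ -(chartHess f x₀ q.2).inverse)
      ((chartAt E x₀ x₀, l), (chartAt E x₀ x₀, l)) :=
    (ContinuousAt.comp (g := fun q ↦ (chartHess f x₀ q).inverse)
      (f := fun q : (E × ℝ) × (E × ℝ) ↦ q.2)
      (x := ((chartAt E x₀ x₀, l), (chartAt E x₀ x₀, l)))
      hs.contDiffAt_inverse.continuousAt continuousAt_snd).neg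
  have d4 : ContinuousAt (fun q : (E × ℝ) × (E × ℝ) ↦
      ContinuousLinearMap.compL ℝ E E E (-(chartHess f x₀ q.2).inverse))
      ((chartAt E x₀ x₀, l), (chartAt E x₀ x₀, l)) :=
    ContinuousAt.comp (ContinuousLinearMap.compL ℝ E E E).continuous.continuousAt d3
  have d5 : ContinuousAt (fun q : (E × ℝ) × (E × ℝ) ↦
      (christoffel x₀ q.1.1).comp (chartHess f x₀ q.1))
      ((chartAt E x₀ x₀, l), (chartAt E x₀ x₀, l)) := d1.clm_comp d2
  exact d4.clm_comp (d5.add continuousAt_const)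

theorem tendsto_comp_uncurry {X Y Z H : Type*} [TopologicalSpace X] [TopologicalSpace Y]
    [TopologicalSpace Z] {Φ : X → Y → Z} {L : Filter H} {u : H → X} {w : H → Y} {x : X} {y : Y}
    (hΦ : ContinuousAt (fun q : X × Y ↦ Φ q.1 q.2) (x, y)) (hu : Tendsto u L (𝓝 x))
    (hw : Tendsto w L (𝓝 y)) : Tendsto (fun h ↦ Φ (u h) (w h)) L (𝓝 (Φ x y)) :=
  hΦ.tendsto.comp (hu.prodMk_nhds hw)

theorem tendsto_chartQuadratic (hs : IsRegularSolution (E := E) V f x₀ l) (hR : IsRetraction R)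
    (B : E →L[ℝ] E →L[ℝ] E) :
    Tendsto (fun h ↦ chartQuadratic f x₀ B (chartPath f R x₀ l h) (chartIterate f R x₀ l h))
      (𝓝[>] 0) (𝓝 (chartQuadratic f x₀ B (chartAt E x₀ x₀, l) (chartAt E x₀ x₀, l))) := by
  exact tendsto_comp_uncurry (Φ := chartQuadratic f x₀ B) (hs.continuousAt_chartQuadratic B)
    ((tendsto_chartPath hR).mono_left nhdsWithin_le_nhds)
    ((hs.tendsto_chartIterate hR).mono_left nhdsWithin_le_nhds)

/-- Quadratic contraction as an exact identity, for any B. With Hess n = -grad at a, the first two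
Taylor terms of `chartStep` add up to -Γ(grad) n = Γ(Hess n) n, which is quadratic in n and forms
part of `chartQuadratic`; only the Taylor remainder is left. -/
theorem chartNewton_chartIterate {B : E →L[ℝ] E →L[ℝ] E} {h : ℝ}
    (hs : IsRegularSolution (E := E) V f x₀ l) (hR : IsRetraction R)
    (hmem : chartPath f R x₀ l h ∈ chartDomain V x₀)
    (hinv : (chartHess f x₀ (chartPath f R x₀ l h)).IsInvertible) :
    chartNewton f x₀ (chartIterate f R x₀ l h)
        - chartQuadratic f x₀ B (chartPath f R x₀ l h) (chartIterate f R x₀ l h)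
          (chartUpdate f R x₀ l h) (chartUpdate f R x₀ l h)
      = -(chartHess f x₀ (chartIterate f R x₀ l h)).inverse
        (chartStep f R x₀ (chartPath f R x₀ l h, chartUpdate f R x₀ l h)
          - chartStep f R x₀ (chartPath f R x₀ l h, 0)
          - fderiv ℝ (chartStep f R x₀) (chartPath f R x₀ l h, 0) (0, chartUpdate f R x₀ l h)
          - B (chartUpdate f R x₀ l h) (chartUpdate f R x₀ l h)) := by
  rw [chartStep_zero hR hmem, fderiv_chartStep hs.isOpen hs.contMDiffOn hR hmem]
  set a := chartPath f R x₀ l h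
  set n := chartUpdate f R x₀ l h with hn
  have h1 : chartHess f x₀ a n = -chartGrad f x₀ a := by
    rw [hn, chartUpdate, chartNewton, map_neg]
    congr 1
    exact (hinv.inverse_apply_eq.1 rfl).symm
  have h2 : fderiv ℝ (chartGrad f x₀) a (n, 0)
      = chartHess f x₀ a n - christoffel x₀ a.1 (chartGrad f x₀ a) n := by
    simp [chartHess]
  have h3 : chartNewton f x₀ (chartIterate f R x₀ l h)
      = -(chartHess f x₀ (chartIterate f R x₀ l h)).inverse (chartStep f R x₀ (a, n)) := rfl
  have h4 : chartQuadratic f x₀ B a (chartIterate f R x₀ l h) n n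
      = -(chartHess f x₀ (chartIterate f R x₀ l h)).inverse
        (christoffel x₀ a.1 (chartHess f x₀ a n) n + B n n) := rfl
  rw [h3, h4, h2, h1]
  simp only [map_sub, map_add, map_neg, neg_apply]
  abel

theorem exists_isLittleO_kappa (hs : IsRegularSolution (E := E) V f x₀ l) (hR : IsRetraction R) :
    ∃ k : ℝ, (fun h ↦ kappa f R x₀ l h - k * h ^ 2) =o[𝓝[>] 0] fun h ↦ h ^ 2 := by
  obtain ⟨v, hv⟩ := hs.exists_isBigO_chartUpdate hR
  obtain ⟨c, hc, hpos⟩ := exists_le_chartMetric (E := E) x₀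
  obtain ⟨B, hB⟩ := exists_isLittleO_taylor_two ((contDiffAt_chartStep hs.isOpen hs.contMDiffOn hR
    hs.mem_chartDomain).of_le (m := 2) (by norm_num))
  have hpath := (tendsto_chartPath (f := f) (x₀ := x₀) (l := l) hR).mono_left
    (nhdsWithin_le_nhds (s := Ioi 0))
  have hiter := (hs.tendsto_chartIterate hR).mono_left (nhdsWithin_le_nhds (s := Ioi 0))
  have hupd := (hs.tendsto_chartUpdate hR).mono_left (nhdsWithin_le_nhds (s := Ioi 0))
  have hG := (contDiffAt_chartMetric (E := E) x₀).continuousAt.tendsto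
  have hinv : Tendsto (fun h ↦ (chartHess f x₀ (chartIterate f R x₀ l h)).inverse) (𝓝[>] 0)
      (𝓝 (chartHess f x₀ (chartAt E x₀ x₀, l)).inverse) :=
    hs.contDiffAt_inverse.continuousAt.tendsto.comp hiter
  have hquad := hs.tendsto_chartQuadratic hR B
  have hrem : (fun h ↦ chartNewton f x₀ (chartIterate f R x₀ l h)
      - chartQuadratic f x₀ B (chartPath f R x₀ l h) (chartIterate f R x₀ l h)
        (chartUpdate f R x₀ l h) (chartUpdate f R x₀ l h))
      =o[𝓝[>] 0] fun h ↦ ‖chartUpdate f R x₀ l h‖ ^ 2 := by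
    have h1 := hB.comp_tendsto (hpath.prodMk_nhds hupd)
    have h2 : (fun h ↦ -(chartHess f x₀ (chartIterate f R x₀ l h)).inverse
        (chartStep f R x₀ (chartPath f R x₀ l h, chartUpdate f R x₀ l h)
          - chartStep f R x₀ (chartPath f R x₀ l h, 0)
          - fderiv ℝ (chartStep f R x₀) (chartPath f R x₀ l h, 0) (0, chartUpdate f R x₀ l h)
          - B (chartUpdate f R x₀ l h) (chartUpdate f R x₀ l h)))
        =o[𝓝[>] 0] fun h ↦ ‖chartUpdate f R x₀ l h‖ ^ 2 := by
      refine IsBigO.trans_isLittleO (IsBigO.of_bound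
        (‖(chartHess f x₀ (chartAt E x₀ x₀, l)).inverse‖ + 1) ?_) h1
      filter_upwards [eventually_norm_le_add_one (F := E →L[ℝ] E) hinv] with h hh
      rw [norm_neg]
      exact ContinuousLinearMap.le_of_opNorm_le _ hh _
    refine h2.congr' ?_ .rfl
    filter_upwards [nhdsWithin_le_nhds (hs.eventually_chartPath_mem hR),
      hpath.eventually hs.eventually_isInvertible_chartHess] with h h3 h4
    exact (hs.chartNewton_chartIterate hR h3 h4).symm
  -- The two lengths are measured at different points, the iterate and the predicted point, but both
  -- metrics tend to the one at the solution.
  obtain ⟨k, hk⟩ := exists_isLittleO_sqrt_div_sub hc hpos (hG.comp hpath.fst_nhds)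
    (hG.comp hiter.fst_nhds) hquad hv hrem
  refine ⟨k, hk.congr' ?_ .rfl⟩
  filter_upwards [nhdsWithin_le_nhds (hs.eventually_norm_firstUpdate hR),
    nhdsWithin_le_nhds (hs.eventually_norm_newtonVector_firstIterate hR)] with h h1 h2
  rw [kappa, h1, h2]
  rfl

theorem transport_predictionVector (hs : IsRegularSolution (E := E) V f x₀ l)
    (T : Π y x : M, TangentSpace 𝓘(ℝ, E) y →L[ℝ] TangentSpace 𝓘(ℝ, E) x) {p : M} {μ : ℝ}
    {q : E × ℝ} (hp : p = chartInv x₀ q.1) (hμ : μ = q.2) (hq : q ∈ chartDomain V x₀) :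
    T p x₀ (predictionVector E f p μ)
      = T (chartInv x₀ q.1) x₀ (chartFrame x₀ (chartInv x₀ q.1) (chartPrediction f x₀ q)) := by
  subst hp hμ
  rw [← chartCoord_predictionVector hs.isOpen hs.contMDiffOn hq,
    chartFrame_chartCoord (chartInv_mem hq.1)]

/-- The prediction vector is C² along the smooth prediction path, and the transport brings it
smoothly into T_{x₀}M. -/
theorem contDiffAt_transportedPrediction (hs : IsRegularSolution (E := E) V f x₀ l)
    (hR : IsRetraction R) {T : Π y x : M, TangentSpace 𝓘(ℝ, E) y →L[ℝ] TangentSpace 𝓘(ℝ, E) x}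
    (hT : IsVectorTransport T) :
    ContDiffAt ℝ 2 (transportedPrediction f R T x₀ l) 0 := by
  have hpred : ContDiffAt ℝ 2 (chartPrediction f x₀) (chartPath f R x₀ l 0) := by
    rw [chartPath_zero hR]
    exact contDiffAt_chartPrediction hs.isOpen hs.contMDiffOn hs.mem_chartDomain
      hs.isInvertible_chartHess
  have hpath : ContDiffAt ℝ 2 (chartPath f R x₀ l) 0 :=
    (contDiffAt_chartPath hR).of_le ENat.LEInfty.out
  have h1 := hT.contDiffAt_comp (x₀ := x₀) (c := fun h ↦ ((chartPath f R x₀ l h).1,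
    chartPrediction f x₀ (chartPath f R x₀ l h)))
    (hpath.fst.prodMk (hpred.comp (0 : ℝ) hpath)) (by simp [chartPath_zero hR])
  refine h1.congr_of_eventuallyEq ?_
  filter_upwards [hs.eventually_predictionPath hR, hs.eventually_chartPath_mem hR] with h h2 h3
  unfold transportedPrediction
  exact hs.transport_predictionVector T (q := chartPath f R x₀ l h) h2 rfl h3

theorem transportedPrediction_zero (hR : IsRetraction R)
    {T : Π y x : M, TangentSpace 𝓘(ℝ, E) y →L[ℝ] TangentSpace 𝓘(ℝ, E) x}
    (hT : IsVectorTransport T) :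
    transportedPrediction f R T x₀ l 0 = predictionVector E f x₀ l := by
  have h1 : predictionPath f R x₀ l 0 = x₀ := by
    rw [predictionPath, zero_smul, hR.map_zero]
  have h2 : ∀ p : M, p = x₀ → T p x₀ (predictionVector E f p (l + 0)) = predictionVector E f x₀ l := by
    rintro _ rfl
    rw [hT.map_self, add_zero]
    rfl
  exact h2 _ h1

theorem exists_isBigO_alpha (hs : IsRegularSolution (E := E) V f x₀ l)
    (hR : IsRetraction R) {T : Π y x : M, TangentSpace 𝓘(ℝ, E) y →L[ℝ] TangentSpace 𝓘(ℝ, E) x}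
    (hT : IsVectorTransport T) (h0 : predictionVector E f x₀ l ≠ 0) :
    ∃ c : ℝ, (fun h ↦ alpha f R T x₀ l h - c * h) =O[𝓝[>] 0] fun h ↦ h ^ 2 := by
  have hz := transportedPrediction_zero (f := f) (x₀ := x₀) (l := l) hR hT
  have := exists_isBigO_arccos_sub (hs.contDiffAt_transportedPrediction hR hT) (by rwa [hz])
  rw [hz] at this
  exact this

end IsRegularSolution

end Asymptotics

end

end RiemannianContinuation

/-! ### The indicator expansions along the solution curve -/

open RiemannianContinuation in
theorem lemma3p4 {E : Type*} [NormedAddCommGroup E] [NormedSpace ℝ E] [FiniteDimensional ℝ E]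
    {M : Type*} [TopologicalSpace M] [ChartedSpace E M] [IsManifold 𝓘(ℝ, E) ∞ M]
    [RiemannianBundle (fun x : M ↦ TangentSpace 𝓘(ℝ, E) x)]
    [IsContMDiffRiemannianBundle 𝓘(ℝ, E) ∞ E (fun x : M ↦ TangentSpace 𝓘(ℝ, E) x)]
    (V : Set (M × ℝ)) (hV : IsOpen V)
    (f : M × ℝ → ℝ) (hf : ContMDiffOn (𝓘(ℝ, E).prod 𝓘(ℝ, ℝ)) 𝓘(ℝ, ℝ) 4 f V)
    (R : TangentBundle 𝓘(ℝ, E) M → M) (hR : IsRetraction R)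
    (T : Π y x : M, TangentSpace 𝓘(ℝ, E) y →L[ℝ] TangentSpace 𝓘(ℝ, E) x)
    (hT : IsVectorTransport T)
    (x : ℝ → M) (hx : IsSolutionCurve (E := E) V f x)
    (hnd : ∀ l ∈ Icc (0 : ℝ) 1,
      covDerivAlong (predictionPath f R (x l) l)
        (covDerivAlong (predictionPath f R (x l) l) (firstUpdate f R (x l) l)) 0 ≠ 0) :
    ∃ δ₂ κ₂ α₁ : M → ℝ → ℝ, ∀ l ∈ Icc (0 : ℝ) 1,
      ((fun h : ℝ ↦ delta f R (x l) l h - δ₂ (x l) l * h ^ 2) =O[𝓝[>] 0] fun h ↦ h ^ 3) ∧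
      ((fun h : ℝ ↦ kappa f R (x l) l h - κ₂ (x l) l * h ^ 2) =o[𝓝[>] 0] fun h ↦ h ^ 2) ∧
      (predictionVector E f (x l) l ≠ 0 →
        (fun h : ℝ ↦ alpha f R T (x l) l h - α₁ (x l) l * h) =O[𝓝[>] 0] fun h ↦ h ^ 2) := by
  -- The coefficients may depend on the point and the parameter only, so they are chosen for every
  -- pair (p, l), with value 0 where the pair is not a regular solution; the curve is inserted
  -- afterwards.
  have hδ : ∀ (p : M) (l : ℝ), ∃ d : ℝ, IsRegularSolution (E := E) V f p l →
      (fun h : ℝ ↦ delta f R p l h - d * h ^ 2) =O[𝓝[>] 0] fun h ↦ h ^ 3 := fun p l ↦ by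
    by_cases hs : IsRegularSolution (E := E) V f p l
    · exact (hs.exists_isBigO_delta hR).imp fun _ h _ ↦ h
    · exact ⟨0, fun h ↦ absurd h hs⟩
  have hκ : ∀ (p : M) (l : ℝ), ∃ k : ℝ, IsRegularSolution (E := E) V f p l →
      (fun h : ℝ ↦ kappa f R p l h - k * h ^ 2) =o[𝓝[>] 0] fun h ↦ h ^ 2 := fun p l ↦ by
    by_cases hs : IsRegularSolution (E := E) V f p l
    · exact (hs.exists_isLittleO_kappa hR).imp fun _ h _ ↦ h
    · exact ⟨0, fun h ↦ absurd h hs⟩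
  have hα : ∀ (p : M) (l : ℝ), ∃ c : ℝ, IsRegularSolution (E := E) V f p l →
      predictionVector E f p l ≠ 0 →
      (fun h : ℝ ↦ alpha f R T p l h - c * h) =O[𝓝[>] 0] fun h ↦ h ^ 2 := fun p l ↦ by
    by_cases hs : IsRegularSolution (E := E) V f p l ∧ predictionVector E f p l ≠ 0
    · exact (hs.1.exists_isBigO_alpha hR hT hs.2).imp fun _ h _ _ ↦ h
    · exact ⟨0, fun h h' ↦ absurd ⟨h, h'⟩ hs⟩
  choose δ₂ hδ using hδ
  choose κ₂ hκ using hκ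
  choose α₁ hα using hα
  refine ⟨δ₂, κ₂, α₁, fun l hl ↦ ?_⟩
  have hs : IsRegularSolution (E := E) V f (x l) l :=
    ⟨hV, hf, hx.mem l hl, hx.grad_eq_zero l hl, hx.hess_isInvertible l hl⟩
  exact ⟨hδ _ _ hs, hκ _ _ hs, hα _ _ hs⟩
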